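/- Let $d\ge 1$ be an integer, $\lambda>0$, $\kappa>0$, $\nu\in\mathbb R$, and put $\omega^2=\kappa(\kappa+2\lambda)$. Let $$\Sigma=\{u\in H^1(\mathbb R^d;\mathbb C):\ x\mapsto |x|u(x)\in L^2(\mathbb R^d)\},$$ and for $u\in\Sigma$ (with $0\ln 0=0$) let $$S_\nu(u)=\tfrac12\|\nabla u\|_{L^2}^2+\tfrac{\omega^2}{2}\int_{\mathbb R^d}|x|^2|u|^2\,dx+\lambda\int_{\mathbb R^d}|u|^2(\ln|u|^2-1)\,dx+\nu\|u\|_{L^2}^2,$$ $$I_\nu(u)=\|\nabla u\|_{L^2}^2+\omega^2\|xu\|_{L^2}^2+2\lambda\int_{\mathbb R^d}|u|^2\ln|u|^2\,dx+2\nu\|u\|_{L^2}^2 .$$ Define the ground energy and the set of ground states by $$D(\nu)=\inf\{S_\nu(u):\ u\in\Sigma\setminus\{0\},\ I_\nu(u)=0\},\qquad \mathcal G_\nu=\{\phi\in\Sigma\setminus\{0\}:\ I_\nu(\phi)=0,\ S_\nu(\phi)=D(\nu)\},$$ and let $\phi_\nu(x)=e^{-\frac{\nu+\kappa d/2}{2\lambda}}e^{-\kappa|x|^2/2}$.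 Then $D(\nu)$ is finite (a true infimum over a nonempty set that is bounded below), $$D(\nu)=-\lambda\|\phi_\nu\|_{L^2}^2=-\lambda\,\pi^{d/2}\kappa^{-d/2}e^{-\frac{\nu+\kappa d/2}{\lambda}},$$ and $$\mathcal G_\nu=\{e^{i\theta}\phi_\nu:\ \theta\in[0,2\pi)\}.$$ -/

import Mathlib

noncomputable section

namespace LogNLS

open MeasureTheory
open scoped SchwartzMap LineDeriv

/-- The space `ℝ^d` with its Euclidean norm. -/
abbrev Space (d : ℕ) : Type := EuclideanSpace ℝ (Fin d)

/-- The space `L²(ℝ^d; ℂ)` of (classes of) square integrable functions for Lebesgue measure. -/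
abbrev L2 (d : ℕ) : Type := Lp ℂ 2 (volume : Measure (Space d))

/-- The `L²` function `g` is the partial derivative `∂_i u` of the `L²` function `u` in the sense
of (tempered) distributions. -/
def IsWeakPartial {d : ℕ} (u : L2 d) (i : Fin d) (g : L2 d) : Prop :=
  ∂_{(EuclideanSpace.single i (1 : ℝ) : Space d)} (u : 𝓢'(Space d, ℂ)) = (g : 𝓢'(Space d, ℂ))

/-- `u ∈ H¹(ℝ^d)`. -/
def MemH1 {d : ℕ} (u : L2 d) : Prop :=
  TemperedDistribution.MemSobolev 1 2 (u : 𝓢'(Space d, ℂ))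

/-- The space `Σ = { f ∈ H¹(ℝ^d) : x ↦ |x| f(x) ∈ L²(ℝ^d) }`. -/
def Sigma (d : ℕ) : Set (L2 d) :=
  {u | MemH1 u ∧ MemLp (fun x : Space d => (‖x‖ : ℂ) * u x) 2 volume}

open Classical in
/-- The partial derivative `∂_i u ∈ L²` of `u` (meaningful as soon as it exists in `L²`, in
particular for `u ∈ H¹`). -/
def weakPartial {d : ℕ} (u : L2 d) (i : Fin d) : L2 d :=
  if h : ∃ g : L2 d, IsWeakPartial u i g then h.choose else 0

/-- For `u ∈ H¹`, `weakPartial u i` is the distributional derivative `∂_i u`. -/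
theorem isWeakPartial_weakPartial {d : ℕ} {u : L2 d} (hu : MemH1 u) (i : Fin d) :
    IsWeakPartial u i (weakPartial u i) := by
  have h : ∃ g : L2 d, IsWeakPartial u i g := by
    have h1 := TemperedDistribution.MemSobolev.lineDerivOp (m := EuclideanSpace.single i (1 : ℝ)) hu
    rw [sub_self, TemperedDistribution.memSobolev_zero_iff] at h1
    exact h1
  rw [weakPartial, dif_pos h]
  exact h.choose_spec

/-- The distributional derivative is unique as an element of `L²`. -/
theorem IsWeakPartial.eq {d : ℕ} {u g : L2 d} {i : Fin d} (hg : IsWeakPartial u i g) :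
    g = weakPartial u i := by
  have h : ∃ g : L2 d, IsWeakPartial u i g := ⟨g, hg⟩
  have h2 : IsWeakPartial u i (weakPartial u i) := by
    rw [weakPartial, dif_pos h]
    exact h.choose_spec
  have h3 : (g : 𝓢'(Space d, ℂ)) = (weakPartial u i : 𝓢'(Space d, ℂ)) := hg.symm.trans h2
  have hk := LinearMap.ker_eq_bot.mp
    (Lp.ker_toTemperedDistributionCLM_eq_bot (F := ℂ) (p := 2) (μ := (volume : Measure (Space d))))
  exact hk h3

/-- `‖∇u‖²_{L²}`. -/
def gradSq {d : ℕ} (u : L2 d) : ℝ := ∑ i : Fin d, ‖weakPartial u i‖ ^ 2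

/-- `‖x u‖²_{L²}`. -/
def momentSq {d : ℕ} (u : L2 d) : ℝ := ∫ x : Space d, ‖x‖ ^ 2 * ‖u x‖ ^ 2

/-- The energy
`E(u) = ½ ‖∇u‖² + ∫ V |u|² + lam ∫ |u|² (ln |u|² - 1)`
of the logarithmic Schrödinger equation with potential `V`. The integrand of the last term is `0`
where `u` vanishes. -/
def energy {d : ℕ} (lam : ℝ) (V : Space d → ℝ) (u : L2 d) : ℝ :=
  1 / 2 * gradSq u + (∫ x : Space d, V x * ‖u x‖ ^ 2)
    + lam * (∫ x : Space d, ‖u x‖ ^ 2 * (Real.log (‖u x‖ ^ 2) - 1))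

/-- `ω² = κ (κ + 2 lam)`. -/
def omegaSq (lam κ : ℝ) : ℝ := κ * (κ + 2 * lam)

/-- The harmonic potential `V(x) = (ω² / 2) |x|²`. -/
def harmonicPotential (d : ℕ) (lam κ : ℝ) (x : Space d) : ℝ := omegaSq lam κ / 2 * ‖x‖ ^ 2

/-- The action `S_ν(u) = E(u) + ν ‖u‖²`. -/
def action {d : ℕ} (lam κ ν : ℝ) (u : L2 d) : ℝ :=
  energy lam (harmonicPotential d lam κ) u + ν * ‖u‖ ^ 2

/-- The Nehari functional
`I_ν(u) = ‖∇u‖² + ω² ‖x u‖² + 2 lam ∫ |u|² ln |u|² + 2 ν ‖u‖²`. -/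
def nehari {d : ℕ} (lam κ ν : ℝ) (u : L2 d) : ℝ :=
  gradSq u + omegaSq lam κ * momentSq u
    + 2 * lam * (∫ x : Space d, ‖u x‖ ^ 2 * Real.log (‖u x‖ ^ 2)) + 2 * ν * ‖u‖ ^ 2

/-- The Nehari manifold `{ u ∈ Σ \ {0} : I_ν(u) = 0 }`. -/
def nehariManifold (d : ℕ) (lam κ ν : ℝ) : Set (L2 d) :=
  {u | u ∈ Sigma d ∧ u ≠ 0 ∧ nehari lam κ ν u = 0}

/-- The ground energy `D(ν) = inf { S_ν(u) : u ∈ Σ \ {0}, I_ν(u) = 0 }`. -/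
def groundEnergy (d : ℕ) (lam κ ν : ℝ) : ℝ :=
  sInf (action lam κ ν '' nehariManifold d lam κ ν)

/-- The set of ground states `{ φ ∈ Σ \ {0} : I_ν(φ) = 0, S_ν(φ) = D(ν) }`. -/
def groundStates (d : ℕ) (lam κ ν : ℝ) : Set (L2 d) :=
  {u | u ∈ nehariManifold d lam κ ν ∧ action lam κ ν u = groundEnergy d lam κ ν}

/-- The function `φ_ν(x) = exp(-(ν + κ d / 2) / (2 lam)) exp(-κ |x|² / 2)`. -/
def gaussonFun (d : ℕ) (lam κ ν : ℝ) (x : Space d) : ℂ :=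
  (Real.exp (-(ν + κ * d / 2) / (2 * lam)) * Real.exp (-κ * ‖x‖ ^ 2 / 2) : ℝ)

theorem memLp_gaussonFun (d : ℕ) (lam : ℝ) {κ : ℝ} (hκ : 0 < κ) (ν : ℝ) :
    MemLp (gaussonFun d lam κ ν) 2 volume := by
  have hc : Continuous (gaussonFun d lam κ ν) := by
    unfold gaussonFun
    fun_prop
  rw [memLp_two_iff_integrable_sq_norm hc.aestronglyMeasurable]
  have h := (GaussianFourier.integrable_cexp_neg_mul_sq_norm_add (V := Space d) (b := (κ : ℂ))
    (by simpa using hκ) 0 0).norm.const_mul (Real.exp (-(ν + κ * d / 2) / (2 * lam)) ^ 2)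
  refine h.congr (Filter.Eventually.of_forall fun x => ?_)
  simp only [gaussonFun, Complex.norm_exp, Complex.norm_real, norm_mul, Real.norm_eq_abs,
    Real.abs_exp, mul_pow]
  congr 1
  rw [← Real.exp_nat_mul]
  congr 1
  have : ((-(κ : ℂ) * (‖x‖ : ℂ) ^ 2 + 0 * ((inner ℝ (0 : Space d) x : ℝ) : ℂ))).re
      = -κ * ‖x‖ ^ 2 := by
    rw [zero_mul, add_zero]
    norm_cast
  rw [this]
  push_cast
  ring

/-- The generalized Gausson `φ_ν` as an element of `L²(ℝ^d)`. -/
def gausson (d : ℕ) (lam : ℝ) {κ : ℝ} (hκ : 0 < κ) (ν : ℝ) : L2 d :=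
  (memLp_gaussonFun d lam hκ ν).toLp (gaussonFun d lam κ ν)

end LogNLS

end

noncomputable section

namespace LogNLS

open MeasureTheory
open scoped SchwartzMap LineDeriv FourierTransform ContDiff ENNReal

/-! Since `S_ν = I_ν / 2 - lam ‖u‖²`, the action on the Nehari manifold is `-lam ‖u‖²`, and
minimising it means maximising the mass. The mass is bounded through two sharp inequalities that
share the Gaussian as their extremal.

The splitting `ω² = κ² + 2 lam κ` separates `I_ν` into two pieces. The `κ²` part completes the
square: `‖∇u‖² + κ² ‖x u‖² = ∑ ‖(∂_i + κ x_i) u‖² + κ d ‖u‖²` (`annihilationSq_eq`), by the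
commutator identity `two_mul_integral_coord`. The `2 lam κ` part is absorbed by the Gibbs inequality
for the entropy of `|u|²` against the weight `exp (a - κ |x|²)` (`gibbs_le_entropy`), with `a`
chosen to cancel the remaining mass terms. Together (`annihilationSq_add_le_nehari`) they give
`I_ν(u) ≥ ∑ ‖(∂_i + κ x_i) u‖² + 2 lam (‖u‖² - ‖φ_ν‖²)`.

Hence `I_ν(u) = 0` forces `‖u‖ ≤ ‖φ_ν‖`, and equality forces `(∂_i + κ x_i) u = 0` for all `i`, so
that `u` is a multiple of the Gaussian (`exists_eq_const_mul_gaussian`); equal mass makes the factor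
a phase.

The analytic cost is the integrability of `|u|² ln |u|²`: the negative part is controlled by the
moment, the positive part by a frequency truncation that works in every dimension. -/

/-! ### Weak derivatives and `H¹` on the Fourier side. -/

/-- A compactly supported smooth function as a Schwartz test function, complex valued. -/
def testFun {d : ℕ} (g : Space d → ℝ) (hg : ContDiff ℝ ∞ g) (hc : HasCompactSupport g) :
    𝓢(Space d, ℂ) :=
  (show HasCompactSupport (Complex.ofRealCLM ∘ g) from hc.comp_left rfl).toSchwartzMap
    (by fun_prop)

theorem testFun_apply {d : ℕ} (g : Space d → ℝ) (hg : ContDiff ℝ ∞ g) (hc : HasCompactSupport g)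
    (x : Space d) : testFun g hg hc x = (g x : ℂ) := rfl

theorem ae_eq_of_forall_schwartz {d : ℕ} {f g : Space d → ℂ}
    (hf : LocallyIntegrable f volume) (hg : LocallyIntegrable g volume)
    (h : ∀ ψ : 𝓢(Space d, ℂ), ∫ x, ψ x * f x = ∫ x, ψ x * g x) : f =ᵐ[volume] g := by
  refine ae_eq_of_integral_contDiff_smul_eq hf hg fun η hη hc => ?_
  have h1 := h (testFun η hη hc)
  simpa only [testFun_apply, Complex.real_smul] using h1

theorem continuous_neg_innerₗ {d : ℕ} :
    Continuous fun p : Space d × Space d => (-innerₗ (Space d)) p.1 p.2 := by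
  simp only [LinearMap.neg_apply, innerₗ_apply_apply]
  fun_prop

/-- For a function in `L¹ ∩ L²`, the `L²` inverse transform agrees a.e. with the integral one,
because both pair identically with Schwartz functions. This makes the low-frequency part of an `L²`
function bounded. -/
theorem ae_norm_fourierInv_le {d : ℕ} (h : L2 d) (hi : Integrable h volume) :
    ∀ᵐ x, ‖(𝓕⁻ h : L2 d) x‖ ≤ ∫ ξ, ‖h ξ‖ := by
  have hcont : Continuous (𝓕⁻ (h : Space d → ℂ)) := by
    have := VectorFourier.fourierIntegral_continuous (V := Space d) (W := Space d)
      Real.continuous_fourierChar (L := -innerₗ (Space d)) continuous_neg_innerₗ hi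
    exact this
  have key : ((𝓕⁻ h : L2 d) : Space d → ℂ) =ᵐ[volume] 𝓕⁻ (h : Space d → ℂ) := by
    refine ae_eq_of_forall_schwartz ((Lp.memLp _).locallyIntegrable (by norm_num))
      hcont.locallyIntegrable fun ψ => ?_
    have h1 := congrArg (fun T : 𝓢'(Space d, ℂ) => T ψ) (Lp.fourierInv_toTemperedDistribution_eq h)
    simp only [TemperedDistribution.fourierInv_apply, Lp.toTemperedDistribution_apply,
      smul_eq_mul] at h1
    rw [← h1]
    have h2 := VectorFourier.integral_fourierIntegral_smul_eq_flip (L := -innerₗ (Space d))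
      (μ := volume) (ν := volume) (f := ψ) (g := (h : Space d → ℂ))
      Real.continuous_fourierChar continuous_neg_innerₗ ψ.integrable hi
    have h3 : (-innerₗ (Space d)).flip = -innerₗ (Space d) := by
      ext x y; simp [real_inner_comm]
    rw [h3] at h2
    simp only [smul_eq_mul] at h2
    rw [SchwartzMap.fourierInv_coe]
    exact h2
  filter_upwards [key] with x hx
  rw [hx]
  exact VectorFourier.norm_fourierIntegral_le_integral_norm _ _ _ _ _

/-- The Fourier transform is injective on tempered distributions and turns `∂_i` into multiplication
by `2πi ξ_i`. -/
theorem isWeakPartial_iff_forall {d : ℕ} {u g : L2 d} {i : Fin d} :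
    IsWeakPartial u i g ↔ ∀ ψ : 𝓢(Space d, ℂ), ∫ ξ, ψ ξ * (𝓕 g : L2 d) ξ
      = ∫ ξ, ψ ξ * (2 * Real.pi * Complex.I * (ξ i : ℂ) * (𝓕 u : L2 d) ξ) := by
  have hinj : IsWeakPartial u i g ↔
      𝓕 (∂_{(EuclideanSpace.single i (1 : ℝ) : Space d)} (u : 𝓢'(Space d, ℂ)))
        = 𝓕 (g : 𝓢'(Space d, ℂ)) := by
    refine ⟨fun h => congrArg _ h, fun h => ?_⟩
    have := congrArg (fun T : 𝓢'(Space d, ℂ) => 𝓕⁻ T) h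
    simp only [FourierTransform.fourierInv_fourier_eq] at this
    exact this
  rw [hinj, TemperedDistribution.fourier_lineDerivOp_eq, Lp.fourier_toTemperedDistribution_eq,
    Lp.fourier_toTemperedDistribution_eq]
  have hT : (fun x : Space d => ((inner ℝ x (EuclideanSpace.single i (1 : ℝ)) : ℝ) : ℂ)
      ).HasTemperateGrowth := by fun_prop
  have hev : ∀ ψ : 𝓢(Space d, ℂ), ((2 * Real.pi * Complex.I) •
      TemperedDistribution.smulLeftCLM ℂ
        (fun x : Space d => ((inner ℝ x (EuclideanSpace.single i (1 : ℝ)) : ℝ) : ℂ))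
        ((𝓕 u : L2 d) : 𝓢'(Space d, ℂ))) ψ
      = ∫ ξ, ψ ξ * (2 * Real.pi * Complex.I * (ξ i : ℂ) * (𝓕 u : L2 d) ξ) := by
    intro ψ
    show (2 * Real.pi * Complex.I) • (TemperedDistribution.smulLeftCLM ℂ _ _ ψ) = _
    rw [TemperedDistribution.smulLeftCLM_apply_apply, Lp.toTemperedDistribution_apply,
      ← integral_smul]
    refine integral_congr_ae (Filter.Eventually.of_forall fun x => ?_)
    simp only [SchwartzMap.smulLeftCLM_apply_apply hT, smul_eq_mul]
    simp [EuclideanSpace.inner_single_right]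
    ring
  constructor
  · intro h ψ
    rw [← hev, h, Lp.toTemperedDistribution_apply]
    rfl
  · intro h
    ext ψ
    rw [hev, ← h, Lp.toTemperedDistribution_apply]
    rfl

theorem isWeakPartial_iff_fourier {d : ℕ} {u g : L2 d} {i : Fin d} :
    IsWeakPartial u i g ↔ ∀ᵐ ξ : Space d,
      (𝓕 g : L2 d) ξ = 2 * Real.pi * Complex.I * (ξ i : ℂ) * (𝓕 u : L2 d) ξ := by
  rw [isWeakPartial_iff_forall]
  refine ⟨fun h => ?_, fun h ψ => integral_congr_ae ?_⟩
  · have hl : LocallyIntegrable ((𝓕 u : L2 d) : Space d → ℂ) volume :=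
      (Lp.memLp _).locallyIntegrable (by norm_num)
    have hc : Continuous fun ξ : Space d => 2 * Real.pi * Complex.I * (ξ i : ℂ) := by fun_prop
    refine ae_eq_of_forall_schwartz ((Lp.memLp _).locallyIntegrable (by norm_num)) ?_
      h
    exact hl.continuous_smul hc
  · filter_upwards [h] with ξ hξ
    rw [hξ]

/-- The Bessel weight `(1 + |ξ|²) ^ r`. -/
def besselWeight (d : ℕ) (r : ℝ) (ξ : Space d) : ℂ := ((1 + ‖ξ‖ ^ 2) ^ r : ℝ)

theorem hasTemperateGrowth_besselWeight (d : ℕ) (r : ℝ) :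
    (besselWeight d r).HasTemperateGrowth := by
  unfold besselWeight
  fun_prop

theorem memH1_iff_fourier {d : ℕ} {u : L2 d} :
    MemH1 u ↔ ∃ F : L2 d, ∀ᵐ ξ : Space d, F ξ = besselWeight d (1 / 2) ξ * (𝓕 u : L2 d) ξ := by
  rw [MemH1, TemperedDistribution.memSobolev_iff_exists_smulLeftCLM_fourier]
  refine exists_congr fun F => ?_
  have hT := hasTemperateGrowth_besselWeight d (1 / 2)
  rw [Lp.fourier_toTemperedDistribution_eq]
  have hev : ∀ ψ : 𝓢(Space d, ℂ), TemperedDistribution.smulLeftCLM ℂ (besselWeight d (1 / 2))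
        ((𝓕 u : L2 d) : 𝓢'(Space d, ℂ)) ψ
      = ∫ ξ, ψ ξ * (besselWeight d (1 / 2) ξ * (𝓕 u : L2 d) ξ) := by
    intro ψ
    rw [TemperedDistribution.smulLeftCLM_apply_apply, Lp.toTemperedDistribution_apply]
    refine integral_congr_ae (Filter.Eventually.of_forall fun x => ?_)
    simp only [SchwartzMap.smulLeftCLM_apply_apply hT, smul_eq_mul]
    ring
  change TemperedDistribution.smulLeftCLM ℂ (besselWeight d (1 / 2)) _ = _ ↔ _
  constructor
  · intro h
    have hl : LocallyIntegrable ((𝓕 u : L2 d) : Space d → ℂ) volume :=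
      (Lp.memLp _).locallyIntegrable (by norm_num)
    refine ae_eq_of_forall_schwartz ((Lp.memLp _).locallyIntegrable (by norm_num))
      (hl.continuous_smul hT.1.continuous) fun ψ => ?_
    have h1 := hev ψ
    rw [h, Lp.toTemperedDistribution_apply] at h1
    exact h1
  · intro h
    ext ψ
    rw [hev, Lp.toTemperedDistribution_apply]
    refine integral_congr_ae ?_
    filter_upwards [h] with ξ hξ
    rw [hξ, smul_eq_mul]

/-- Integration by parts through Plancherel: the multiplier `2πi ξ_i` is purely imaginary. -/
theorem inner_weakPartial {d : ℕ} {u v g k : L2 d} {i : Fin d} (hg : IsWeakPartial u i g)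
    (hk : IsWeakPartial v i k) : inner ℂ v g = - inner ℂ k u := by
  rw [← Lp.inner_fourier_eq v g, ← Lp.inner_fourier_eq k u, L2.inner_def, L2.inner_def,
    ← integral_neg]
  refine integral_congr_ae ?_
  filter_upwards [isWeakPartial_iff_fourier.1 hg, isWeakPartial_iff_fourier.1 hk] with ξ h1 h2
  rw [h1, h2]
  simp [Complex.conj_ofNat]
  ring

theorem norm_sq_eq_integral {d : ℕ} (u : L2 d) : ‖u‖ ^ 2 = ∫ x, ‖u x‖ ^ 2 := by
  have h := L2.inner_def (𝕜 := ℂ) u u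
  rw [inner_self_eq_norm_sq_to_K] at h
  have h2 : (fun x => inner ℂ (u x) (u x)) = fun x => ((‖u x‖ ^ 2 : ℝ) : ℂ) := by
    funext x
    rw [inner_self_eq_norm_sq_to_K]
    norm_cast
  rw [h2, integral_complex_ofReal] at h
  exact Complex.ofReal_injective (by rw [Complex.ofReal_pow]; exact h)

theorem integrable_norm_sq {d : ℕ} (u : L2 d) : Integrable (fun x => ‖u x‖ ^ 2) volume :=
  (Lp.memLp u).integrable_norm_pow two_ne_zero

/-! ### Frequency truncation and the positive part of `|u|² ln |u|²`. -/

/-- The low-frequency part of an `L²` function, in Fourier variables. -/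
def lowFreq {d : ℕ} (h : L2 d) (R : ℝ) : L2 d :=
  ((Lp.memLp h).indicator (s := Metric.ball (0 : Space d) R)
    measurableSet_ball).toLp _

theorem lowFreq_ae {d : ℕ} (h : L2 d) (R : ℝ) :
    lowFreq h R =ᵐ[volume] (Metric.ball (0 : Space d) R).indicator h :=
  MemLp.coeFn_toLp _

theorem integrable_lowFreq {d : ℕ} (h : L2 d) (R : ℝ) : Integrable (lowFreq h R) volume := by
  refine Integrable.congr ?_ (lowFreq_ae h R).symm
  rw [integrable_indicator_iff measurableSet_ball]
  have : IsFiniteMeasure (volume.restrict (Metric.ball (0 : Space d) R)) :=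
    ⟨by rw [Measure.restrict_apply_univ]; exact measure_ball_lt_top⟩
  exact ((Lp.memLp h).restrict _).integrable (by norm_num)

theorem integral_norm_lowFreq_le {d : ℕ} (h : L2 d) (n : ℕ) :
    ∫ ξ, ‖lowFreq h (4 ^ n) ξ‖ ≤
      (2 ^ (n * d) : ℝ) * ((volume.real (Metric.ball (0 : Space d) 1) + ‖h‖ ^ 2) / 2) := by
  have h1 : ∫ ξ, ‖lowFreq h (4 ^ n) ξ‖ = ∫ ξ in Metric.ball (0 : Space d) (4 ^ n), ‖h ξ‖ := by
    rw [← integral_indicator measurableSet_ball]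
    refine integral_congr_ae ?_
    filter_upwards [lowFreq_ae h (4 ^ n)] with ξ hξ
    rw [hξ, norm_indicator_eq_indicator_norm]
  -- Up to a constant, `s` is the square root of the volume of the ball of radius `4 ^ n`; the base
  -- 4 keeps it an integer power. With this weight, AM-GM replaces Cauchy-Schwarz below.
  set s : ℝ := 2 ^ (n * d) with hs
  have hs0 : 0 < s := by positivity
  have hvol : volume.real (Metric.ball (0 : Space d) (4 ^ n))
      = s ^ 2 * volume.real (Metric.ball (0 : Space d) 1) := by
    rw [Measure.real, Measure.addHaar_ball_of_pos _ _ (by positivity), ENNReal.toReal_mul,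
      ENNReal.toReal_ofReal (by positivity), finrank_euclideanSpace, Fintype.card_fin,
      ← Measure.real]
    rw [hs, ← pow_mul, ← pow_mul]
    congr 1
    rw [show (4 : ℝ) = 2 ^ 2 by norm_num, ← pow_mul]
    congr 1
    ring
  have : IsFiniteMeasure (volume.restrict (Metric.ball (0 : Space d) (4 ^ n))) :=
    ⟨by rw [Measure.restrict_apply_univ]; exact measure_ball_lt_top⟩
  have hi2 := (integrable_norm_sq h).restrict (s := Metric.ball (0 : Space d) (4 ^ n))
  calc ∫ ξ, ‖lowFreq h (4 ^ n) ξ‖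
      = ∫ ξ in Metric.ball (0 : Space d) (4 ^ n), ‖h ξ‖ := h1
    _ ≤ ∫ ξ in Metric.ball (0 : Space d) (4 ^ n), (s⁻¹ / 2 + s / 2 * ‖h ξ‖ ^ 2) := by
        refine integral_mono (((Lp.memLp h).restrict _).integrable (by norm_num)).norm
          ((integrable_const _).add (hi2.const_mul _)) fun ξ => ?_
        have : 0 ≤ (s * ‖h ξ‖ - 1) ^ 2 / (2 * s) := by positivity
        have e : (s * ‖h ξ‖ - 1) ^ 2 / (2 * s) = (s⁻¹ / 2 + s / 2 * ‖h ξ‖ ^ 2) - ‖h ξ‖ := by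
          field_simp
          ring
        simp only
        linarith
    _ = volume.real (Metric.ball (0 : Space d) (4 ^ n)) * (s⁻¹ / 2)
        + s / 2 * ∫ ξ in Metric.ball (0 : Space d) (4 ^ n), ‖h ξ‖ ^ 2 := by
        rw [integral_add (integrable_const _) (hi2.const_mul _), integral_const_mul]
        simp [Measure.real]
    _ ≤ s * ((volume.real (Metric.ball (0 : Space d) 1) + ‖h‖ ^ 2) / 2) := by
        rw [hvol]
        have h3 : ∫ ξ in Metric.ball (0 : Space d) (4 ^ n), ‖h ξ‖ ^ 2 ≤ ‖h‖ ^ 2 := by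
          rw [norm_sq_eq_integral]
          exact setIntegral_le_integral (integrable_norm_sq h)
            (Filter.Eventually.of_forall fun x => by positivity)
        have h4 : s / 2 * ∫ ξ in Metric.ball (0 : Space d) (4 ^ n), ‖h ξ‖ ^ 2
          ≤ s / 2 * ‖h‖ ^ 2 := by gcongr
        have e : s ^ 2 * volume.real (Metric.ball (0 : Space d) 1) * (s⁻¹ / 2)
          = s / 2 * volume.real (Metric.ball (0 : Space d) 1) := by
          field_simp
        linarith

theorem norm_sq_besselWeight_half {d : ℕ} (ξ : Space d) :
    ‖besselWeight d (1 / 2) ξ‖ ^ 2 = 1 + ‖ξ‖ ^ 2 := by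
  have h : (0 : ℝ) ≤ 1 + ‖ξ‖ ^ 2 := by positivity
  rw [besselWeight, Complex.norm_real, Real.norm_eq_abs, sq_abs, ← Real.sqrt_eq_rpow,
    Real.sq_sqrt h]

theorem norm_sq_sub_lowFreq_le {d : ℕ} {h F : L2 d}
    (hF : ∀ᵐ ξ : Space d, F ξ = besselWeight d (1 / 2) ξ * h ξ) {R : ℝ} (hR : 0 < R) :
    ‖h - lowFreq h R‖ ^ 2 ≤ ‖F‖ ^ 2 / R ^ 2 := by
  rw [norm_sq_eq_integral, norm_sq_eq_integral F, ← integral_div]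
  refine integral_mono_ae (integrable_norm_sq _) ((integrable_norm_sq F).div_const _) ?_
  filter_upwards [hF, lowFreq_ae h R, Lp.coeFn_sub h (lowFreq h R)] with ξ h1 h2 h3
  rw [h3, Pi.sub_apply, h2, h1, norm_mul, mul_pow, norm_sq_besselWeight_half]
  by_cases hξ : ξ ∈ Metric.ball (0 : Space d) R
  · rw [Set.indicator_of_mem hξ, sub_self, norm_zero, zero_pow two_ne_zero]
    positivity
  · rw [Set.indicator_of_notMem hξ, sub_zero, le_div_iff₀ (by positivity)]
    have : R ≤ ‖ξ‖ := by simpa using hξ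
    have h4 : R ^ 2 ≤ 1 + ‖ξ‖ ^ 2 := by nlinarith
    nlinarith [sq_nonneg ‖h ξ‖]

/-- Tails of an `H¹` function over its high level sets decay geometrically. -/
theorem exists_lintegral_level_le {d : ℕ} {u : L2 d} (hu : MemH1 u) :
    ∃ K C : ℝ, 1 ≤ K ∧ 0 ≤ C ∧ ∀ n : ℕ,
      ∫⁻ x, ENNReal.ofReal ({x | K * 2 ^ (n * d) ≤ ‖u x‖}.indicator (fun x => ‖u x‖ ^ 2) x)
        ≤ ENNReal.ofReal (C * (1 / 16) ^ n) := by
  obtain ⟨F, hF⟩ := memH1_iff_fourier.1 hu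
  set h : L2 d := 𝓕 u with hh
  -- `K * 2 ^ (n * d)` is at least twice the sup bound on the low-frequency part `v`, and the `+ 1`
  -- ensures `1 ≤ K`. On the level set `|v| ≤ |u| / 2`, so `|u|² ≤ 4 |u - v|²`, whence `C`. The rate
  -- `1 / 16` is the squared inverse of the cutoff radius `4 ^ n`.
  refine ⟨volume.real (Metric.ball (0 : Space d) 1) + ‖h‖ ^ 2 + 1, 4 * ‖F‖ ^ 2, ?_, by positivity,
    fun n => ?_⟩
  · have : 0 ≤ volume.real (Metric.ball (0 : Space d) 1) := measureReal_nonneg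
    nlinarith [sq_nonneg ‖h‖]
  set V := volume.real (Metric.ball (0 : Space d) 1) with hV
  set v : L2 d := 𝓕⁻ (lowFreq h (4 ^ n)) with hv
  have hvle := ae_norm_fourierInv_le _ (integrable_lowFreq h (4 ^ n))
  have hle := integral_norm_lowFreq_le h n
  have hd : ‖u - v‖ ^ 2 ≤ ‖F‖ ^ 2 / (4 ^ n) ^ 2 := by
    refine le_trans (le_of_eq ?_) (norm_sq_sub_lowFreq_le hF (by positivity))
    rw [← Lp.norm_fourier_eq (u - v), sub_eq_add_neg, FourierTransform.fourier_add,
      FourierTransform.fourier_neg, hv, FourierTransform.fourier_fourierInv_eq, ← sub_eq_add_neg]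
  calc ∫⁻ x, ENNReal.ofReal
        ({x | (V + ‖h‖ ^ 2 + 1) * 2 ^ (n * d) ≤ ‖u x‖}.indicator (fun x => ‖u x‖ ^ 2) x)
      ≤ ∫⁻ x, ENNReal.ofReal (4 * ‖(u - v) x‖ ^ 2) := by
        refine lintegral_mono_ae ?_
        filter_upwards [hvle, Lp.coeFn_sub u v] with x hx h2
        refine ENNReal.ofReal_le_ofReal ?_
        rw [h2, Pi.sub_apply]
        by_cases hl : x ∈ {x | (V + ‖h‖ ^ 2 + 1) * 2 ^ (n * d) ≤ ‖u x‖}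
        · rw [Set.indicator_of_mem hl]
          have hl' : (V + ‖h‖ ^ 2 + 1) * 2 ^ (n * d) ≤ ‖u x‖ := hl
          have hp : (0 : ℝ) < 2 ^ (n * d) := by positivity
          have h3 : ‖v x‖ ≤ ‖u x‖ / 2 := by nlinarith
          have h4 : ‖u x‖ ≤ 2 * ‖u x - v x‖ := by
            have := norm_sub_norm_le (u x) (v x)
            linarith
          nlinarith [norm_nonneg (u x)]
        · rw [Set.indicator_of_notMem hl]
          positivity
    _ = ENNReal.ofReal (4 * ‖u - v‖ ^ 2) := by
        rw [norm_sq_eq_integral, ← integral_const_mul,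
          ofReal_integral_eq_lintegral_ofReal ((integrable_norm_sq _).const_mul _)
          (Filter.Eventually.of_forall fun x => by positivity)]
    _ ≤ ENNReal.ofReal (4 * ‖F‖ ^ 2 * (1 / 16) ^ n) := by
        refine ENNReal.ofReal_le_ofReal ?_
        have e : ((1 : ℝ) / 16) ^ n = 1 / (4 ^ n) ^ 2 := by
          rw [← pow_mul, mul_comm n 2, pow_mul, one_div_pow]; norm_num
        rw [e]
        calc _ ≤ 4 * (‖F‖ ^ 2 / (4 ^ n) ^ 2) := by gcongr
          _ = _ := by ring

theorem log_sq_le_of_lt {K q y : ℝ} (hK : 1 ≤ K) (hq : 1 ≤ q) (hy : 0 ≤ y) {N : ℕ}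
    (h : y < K * q ^ N) : Real.log (y ^ 2) ≤ 2 * Real.log K + 2 * Real.log q * N := by
  have hK0 : 0 < K := by linarith
  have hq0 : 0 < q := by linarith
  rcases hy.eq_or_lt with rfl | hy
  · have := Real.log_nonneg hK
    have := Real.log_nonneg hq
    simp only [ne_eq, OfNat.ofNat_ne_zero, not_false_eq_true, zero_pow, Real.log_zero]
    positivity
  · have := Real.log_le_log hy h.le
    rw [Real.log_mul hK0.ne' (by positivity), Real.log_pow] at this
    rw [Real.log_pow]
    push_cast
    linarith

theorem measurableSet_level {d : ℕ} (u : L2 d) (t : ℝ) : MeasurableSet {x | t ≤ ‖u x‖} :=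
  measurableSet_le measurable_const (Lp.stronglyMeasurable u).measurable.norm

/-- The logarithm of `|u|²` grows at most linearly in the number of levels `K q ^ n` that `|u|` has
reached, so the integrand is dominated by `|u|²` plus the sum over `n` of the tails over the level
sets, which form a geometric series. `1 ≤ d` gives `q > 1`, so that the levels are unbounded. -/
theorem integrable_posPart_sq_log {d : ℕ} (hd : 1 ≤ d) {u : L2 d} (hu : MemH1 u) :
    Integrable (fun x => max (‖u x‖ ^ 2 * Real.log (‖u x‖ ^ 2)) 0) volume := by
  obtain ⟨K, C, hK, hC, hlev⟩ := exists_lintegral_level_le hu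
  have hmeas := (Lp.stronglyMeasurable u).measurable
  set A : ℕ → Set (Space d) := fun n => {x | K * 2 ^ (n * d) ≤ ‖u x‖} with hA
  set q : ℝ := 2 ^ d with hq
  have hq1 : 1 < q := one_lt_pow₀ (by norm_num) (by omega)
  have hsum : ∫⁻ x, ∑' n, ENNReal.ofReal ((A n).indicator (fun x => ‖u x‖ ^ 2) x) < ⊤ := by
    rw [lintegral_tsum fun n => (((hmeas.norm.pow_const 2).indicator
      (measurableSet_level u _)).ennreal_ofReal).aemeasurable]
    refine lt_of_le_of_lt (ENNReal.tsum_le_tsum hlev) ?_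
    rw [← ENNReal.ofReal_tsum_of_nonneg (fun n => by positivity)
      ((summable_geometric_of_lt_one (by norm_num) (by norm_num)).mul_left C)]
    exact ENNReal.ofReal_lt_top
  have hu2 : ∫⁻ x, ENNReal.ofReal (‖u x‖ ^ 2) < ⊤ :=
    (integrable_norm_sq u).lintegral_lt_top
  have hpt : ∀ x, ‖max (‖u x‖ ^ 2 * Real.log (‖u x‖ ^ 2)) 0‖ₑ
      ≤ ENNReal.ofReal (2 * Real.log K) * ENNReal.ofReal (‖u x‖ ^ 2)
        + ENNReal.ofReal (2 * Real.log q)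
          * ∑' n, ENNReal.ofReal ((A n).indicator (fun x => ‖u x‖ ^ 2) x) := by
    intro x
    have hlogK : 0 ≤ 2 * Real.log K := by have := Real.log_nonneg hK; positivity
    have hlogq : 0 ≤ 2 * Real.log q := by have := Real.log_nonneg hq1.le; positivity
    have hex : ∃ N : ℕ, ‖u x‖ < K * q ^ N := by
      obtain ⟨N, hN⟩ := pow_unbounded_of_one_lt ‖u x‖ hq1
      exact ⟨N, hN.trans_le (le_mul_of_one_le_left (by positivity) hK)⟩
    classical
    set N := Nat.find hex with hNdef
    have hN : ‖u x‖ < K * q ^ N := Nat.find_spec hex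
    have hbelow : ∀ n < N, x ∈ A n := fun n hn => by
      have := not_lt.1 (Nat.find_min hex hn)
      rw [hq, ← pow_mul, mul_comm d n] at this
      exact this
    -- `x` lies in every level set below the first level exceeding `|u x|`, so the series counts `|u
    -- x|²` at least `N` times.
    have hNsum : (N : ℝ≥0∞) * ENNReal.ofReal (‖u x‖ ^ 2)
        ≤ ∑' n, ENNReal.ofReal ((A n).indicator (fun x => ‖u x‖ ^ 2) x) := by
      refine le_trans (le_of_eq ?_) (ENNReal.sum_le_tsum (Finset.range N))
      rw [Finset.sum_congr rfl fun n hn => by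
        rw [Set.indicator_of_mem (hbelow n (Finset.mem_range.1 hn))]]
      simp
    have hlog := log_sq_le_of_lt hK hq1.le (norm_nonneg (u x)) hN
    calc ‖max (‖u x‖ ^ 2 * Real.log (‖u x‖ ^ 2)) 0‖ₑ
        = ENNReal.ofReal (max (‖u x‖ ^ 2 * Real.log (‖u x‖ ^ 2)) 0) := by
          rw [Real.enorm_eq_ofReal (le_max_right _ _)]
      _ ≤ ENNReal.ofReal (2 * Real.log K * ‖u x‖ ^ 2
            + 2 * Real.log q * (N * ‖u x‖ ^ 2)) := by
          refine ENNReal.ofReal_le_ofReal (max_le ?_ (by positivity))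
          nlinarith [sq_nonneg ‖u x‖]
      _ = ENNReal.ofReal (2 * Real.log K) * ENNReal.ofReal (‖u x‖ ^ 2)
          + ENNReal.ofReal (2 * Real.log q) * (N * ENNReal.ofReal (‖u x‖ ^ 2)) := by
          rw [ENNReal.ofReal_add (by positivity) (by positivity), ENNReal.ofReal_mul hlogK,
            ENNReal.ofReal_mul hlogq, ENNReal.ofReal_mul (Nat.cast_nonneg N),
            ENNReal.ofReal_natCast]
      _ ≤ _ := by gcongr
  refine ⟨Measurable.aestronglyMeasurable ?_, lt_of_le_of_lt (lintegral_mono hpt) ?_⟩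
  · exact ((hmeas.norm.pow_const 2).mul (hmeas.norm.pow_const 2).log).max measurable_const
  · have hm1 : Measurable fun x => ENNReal.ofReal (‖u x‖ ^ 2) :=
      (hmeas.norm.pow_const 2).ennreal_ofReal
    rw [lintegral_add_left (hm1.const_mul _), lintegral_const_mul' _ _ ENNReal.ofReal_ne_top,
      lintegral_const_mul' _ _ ENNReal.ofReal_ne_top]
    exact ENNReal.add_lt_top.2 ⟨ENNReal.mul_lt_top ENNReal.ofReal_lt_top hu2,
      ENNReal.mul_lt_top ENNReal.ofReal_lt_top hsum⟩

/-! ### Leibniz rule, commutator identity and completion of the square. -/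

theorem isWeakPartial_iff_integral {d : ℕ} {u g : L2 d} {i : Fin d} :
    IsWeakPartial u i g ↔ ∀ ψ : 𝓢(Space d, ℂ), ∫ x, ψ x * g x
      = -∫ x, fderiv ℝ ψ x (EuclideanSpace.single i 1) * u x := by
  have hev : ∀ ψ : 𝓢(Space d, ℂ),
      (∂_{(EuclideanSpace.single i (1 : ℝ) : Space d)} (u : 𝓢'(Space d, ℂ))) ψ
        = -∫ x, fderiv ℝ ψ x (EuclideanSpace.single i 1) * u x := by
    intro ψ
    rw [TemperedDistribution.lineDerivOp_apply_apply, map_neg, Lp.toTemperedDistribution_apply]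
    rfl
  constructor
  · intro h ψ
    rw [← hev, h, Lp.toTemperedDistribution_apply]
    rfl
  · intro h
    ext ψ
    rw [hev, ← h, Lp.toTemperedDistribution_apply]
    rfl

theorem integrable_schwartz_mul {d : ℕ} (ψ : 𝓢(Space d, ℂ)) (u : L2 d) :
    Integrable (fun x => ψ x * u x) volume :=
  (ψ.memLp 2).integrable_mul (Lp.memLp u)

theorem integrable_fderiv_schwartz_mul {d : ℕ} (ψ : 𝓢(Space d, ℂ)) (e : Space d) (u : L2 d) :
    Integrable (fun x => fderiv ℝ ψ x e * u x) volume :=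
  integrable_schwartz_mul (∂_{e} ψ) u

/-- The Leibniz rule for the product of an `L²` function with a smooth function. -/
theorem isWeakPartial_mul {d : ℕ} {u g v k : L2 d} {i : Fin d} (h : IsWeakPartial u i g)
    {m m' : Space d → ℂ} (hm : m.HasTemperateGrowth)
    (hm' : ∀ x, fderiv ℝ m x (EuclideanSpace.single i 1) = m' x)
    (hv : ∀ᵐ x, v x = m x * u x) (hk : ∀ᵐ x, k x = m' x * u x + m x * g x) :
    IsWeakPartial v i k := by
  rw [isWeakPartial_iff_integral] at h ⊢
  intro ψ
  set Ψ := SchwartzMap.smulLeftCLM ℂ m ψ with hΨ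
  have hΨ1 : ∀ x, Ψ x = m x * ψ x := fun x => by
    rw [hΨ, SchwartzMap.smulLeftCLM_apply_apply hm, smul_eq_mul]
  have hΨ2 : ∀ x, fderiv ℝ Ψ x (EuclideanSpace.single i 1)
      = m' x * ψ x + m x * fderiv ℝ ψ x (EuclideanSpace.single i 1) := fun x => by
    have e : (Ψ : Space d → ℂ) = fun x => m x * ψ x := funext hΨ1
    rw [e, fderiv_fun_mul (hm.1.differentiable (by simp) x) ψ.differentiableAt]
    simp [hm']
    ring
  have h1 := h Ψ
  rw [eq_neg_iff_add_eq_zero] at h1 ⊢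
  rw [← integral_add (integrable_schwartz_mul _ _) (integrable_fderiv_schwartz_mul _ _ _)]
    at h1 ⊢
  rw [← h1]
  refine integral_congr_ae ?_
  filter_upwards [hv, hk] with x h2 h3
  rw [h2, h3, hΨ1, hΨ2]
  ring

/-- A bounded smooth approximation of the coordinate `x_i`. -/
def coordCutoff (d : ℕ) (i : Fin d) (c : ℝ) (x : Space d) : ℝ :=
  x i * (1 + ‖c • x‖ ^ 2) ^ (-1 : ℝ)

theorem hasTemperateGrowth_coordCutoff {d : ℕ} (i : Fin d) (c : ℝ) :
    (fun x => (coordCutoff d i c x : ℂ)).HasTemperateGrowth := by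
  have h1 : (fun x : Space d => (1 + ‖c • x‖ ^ 2) ^ (-1 : ℝ)).HasTemperateGrowth :=
    (Function.hasTemperateGrowth_one_add_norm_sq_rpow (Space d) (-1)).comp
      (by fun_prop : (fun x : Space d => c • x).HasTemperateGrowth)
  have h2 : (fun x : Space d => x i).HasTemperateGrowth :=
    (EuclideanSpace.proj (𝕜 := ℝ) i : Space d →L[ℝ] ℝ).hasTemperateGrowth
  unfold coordCutoff
  fun_prop

theorem coordCutoff_eq {d : ℕ} (i : Fin d) (c : ℝ) (x : Space d) :
    coordCutoff d i c x = x i * (1 + c ^ 2 * ‖x‖ ^ 2)⁻¹ := by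
  rw [coordCutoff, Real.rpow_neg_one, norm_smul, mul_pow, Real.norm_eq_abs, sq_abs]

/-- The `i`-th partial derivative of `coordCutoff`. -/
def coordCutoffDeriv (d : ℕ) (i : Fin d) (c : ℝ) (x : Space d) : ℝ :=
  (1 + c ^ 2 * ‖x‖ ^ 2)⁻¹ - 2 * (c ^ 2 * x i ^ 2) * ((1 + c ^ 2 * ‖x‖ ^ 2)⁻¹) ^ 2

theorem hasFDerivAt_norm_sq {d : ℕ} (x : Space d) :
    HasFDerivAt (fun x : Space d => ‖x‖ ^ 2) (2 • innerSL ℝ x) x :=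
  (hasStrictFDerivAt_norm_sq x).hasFDerivAt

theorem fderiv_coordCutoff {d : ℕ} (i : Fin d) (c : ℝ) (x : Space d) :
    fderiv ℝ (fun x => (coordCutoff d i c x : ℂ)) x (EuclideanSpace.single i 1)
      = coordCutoffDeriv d i c x := by
  have hpos : (1 + c ^ 2 * ‖x‖ ^ 2) ≠ 0 := by positivity
  have h1 : HasFDerivAt (fun x : Space d => x i) (EuclideanSpace.proj (𝕜 := ℝ) i) x :=
    (EuclideanSpace.proj (𝕜 := ℝ) i : Space d →L[ℝ] ℝ).hasFDerivAt
  have h2 := ((hasFDerivAt_norm_sq x).const_mul (c ^ 2)).const_add 1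
  have h3 := h1.mul ((hasDerivAt_inv hpos).comp_hasFDerivAt x h2)
  have h4 : HasFDerivAt (fun x => (coordCutoff d i c x : ℂ)) _ x :=
    (Complex.ofRealCLM.hasFDerivAt.comp x h3).congr_of_eventuallyEq
      (Filter.Eventually.of_forall fun y => by simp [coordCutoff_eq])
  rw [h4.fderiv]
  simp [coordCutoffDeriv, EuclideanSpace.inner_single_right]
  ring

theorem sq_coord_le {d : ℕ} (i : Fin d) (x : Space d) : x i ^ 2 ≤ ‖x‖ ^ 2 := by
  rw [EuclideanSpace.real_norm_sq_eq]
  exact Finset.single_le_sum (f := fun j => x j ^ 2) (fun j _ => sq_nonneg _) (Finset.mem_univ i)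

theorem abs_coordCutoff_le {d : ℕ} (i : Fin d) (c : ℝ) (x : Space d) :
    |coordCutoff d i c x| ≤ |x i| := by
  rw [coordCutoff_eq, abs_mul]
  refine mul_le_of_le_one_right (abs_nonneg _) ?_
  rw [abs_of_nonneg (by positivity)]
  exact inv_le_one_of_one_le₀ (le_add_of_nonneg_right (by positivity))

theorem abs_coordCutoffDeriv_le {d : ℕ} (i : Fin d) (c : ℝ) (x : Space d) :
    |coordCutoffDeriv d i c x| ≤ 3 := by
  have hi := sq_coord_le i x
  set t := c ^ 2 * ‖x‖ ^ 2 with ht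
  have ht0 : 0 ≤ t := by positivity
  have h1 : c ^ 2 * x i ^ 2 ≤ t := by rw [ht]; gcongr
  have h1' : 0 ≤ c ^ 2 * x i ^ 2 := by positivity
  have h2 : (1 + t)⁻¹ ≤ 1 := inv_le_one_of_one_le₀ (by linarith)
  have h3 : 0 ≤ (1 + t)⁻¹ := by positivity
  have h4 : t * (1 + t)⁻¹ ≤ 1 := by
    rw [← div_eq_mul_inv, div_le_one (by positivity)]; linarith
  have h5 : c ^ 2 * x i ^ 2 * ((1 + t)⁻¹) ^ 2 ≤ 1 := by
    calc c ^ 2 * x i ^ 2 * ((1 + t)⁻¹) ^ 2 ≤ t * ((1 + t)⁻¹) ^ 2 := by gcongr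
      _ = (t * (1 + t)⁻¹) * (1 + t)⁻¹ := by ring
      _ ≤ 1 := mul_le_one₀ h4 h3 h2
  have h6 : 0 ≤ c ^ 2 * x i ^ 2 * ((1 + t)⁻¹) ^ 2 := by positivity
  rw [coordCutoffDeriv, ← ht, abs_le]
  constructor <;> linarith

theorem tendsto_coordCutoff {d : ℕ} (i : Fin d) (x : Space d) :
    Filter.Tendsto (fun n : ℕ => coordCutoff d i (1 / ((n : ℝ) + 1)) x) Filter.atTop
      (nhds (x i)) := by
  have h0 := tendsto_one_div_add_atTop_nhds_zero_nat (𝕜 := ℝ)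
  have hc : Continuous fun c : ℝ => x i * (1 + c ^ 2 * ‖x‖ ^ 2)⁻¹ := by
    refine continuous_const.mul (Continuous.inv₀ (by fun_prop) fun c => by positivity)
  have := (hc.tendsto 0).comp h0
  simpa [Function.comp_def, coordCutoff_eq] using this

theorem tendsto_coordCutoffDeriv {d : ℕ} (i : Fin d) (x : Space d) :
    Filter.Tendsto (fun n : ℕ => coordCutoffDeriv d i (1 / ((n : ℝ) + 1)) x) Filter.atTop
      (nhds 1) := by
  have h0 := tendsto_one_div_add_atTop_nhds_zero_nat (𝕜 := ℝ)
  have hi : Continuous fun c : ℝ => (1 + c ^ 2 * ‖x‖ ^ 2)⁻¹ :=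
    Continuous.inv₀ (by fun_prop) fun c => by positivity
  have hc : Continuous fun c : ℝ => coordCutoffDeriv d i c x := by
    unfold coordCutoffDeriv
    fun_prop
  have := (hc.tendsto 0).comp h0
  simpa [Function.comp_def, coordCutoffDeriv] using this

theorem continuous_coordCutoff {d : ℕ} (i : Fin d) (c : ℝ) : Continuous (coordCutoff d i c) := by
  have : coordCutoff d i c = fun x => x i * (1 + c ^ 2 * ‖x‖ ^ 2)⁻¹ :=
    funext (coordCutoff_eq i c)
  rw [this]
  exact (by fun_prop : Continuous fun x : Space d => x i).mul
    (Continuous.inv₀ (by fun_prop) fun c => by positivity)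

theorem continuous_coordCutoffDeriv {d : ℕ} (i : Fin d) (c : ℝ) :
    Continuous (coordCutoffDeriv d i c) := by
  have hi : Continuous fun x : Space d => (1 + c ^ 2 * ‖x‖ ^ 2)⁻¹ :=
    Continuous.inv₀ (by fun_prop) fun c => by positivity
  unfold coordCutoffDeriv
  fun_prop

/-- This bound blows up as `c → 0` and serves only to keep the truncated products in `L²`; the
passage to the limit relies on `abs_coordCutoff_le`. -/
theorem abs_coordCutoff_le_div {d : ℕ} (i : Fin d) {c : ℝ} (hc : 0 < c) (x : Space d) :
    |coordCutoff d i c x| ≤ 1 / (2 * c) := by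
  have h1 : |x i| ≤ ‖x‖ := by
    have := sq_coord_le i x
    exact abs_le_of_sq_le_sq this (norm_nonneg x)
  rw [coordCutoff_eq, abs_mul, abs_of_nonneg (a := (1 + c ^ 2 * ‖x‖ ^ 2)⁻¹) (by positivity),
    ← div_eq_mul_inv, div_le_div_iff₀ (by positivity) (by positivity)]
  nlinarith [sq_nonneg (c * ‖x‖ - 1)]

theorem memLp_mul_of_abs_le {d : ℕ} {m : Space d → ℝ} (hm : Continuous m) {C : ℝ}
    (hC : ∀ x, |m x| ≤ C) (u : L2 d) : MemLp (fun x => (m x : ℂ) * u x) 2 volume := by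
  refine MemLp.of_le_mul (c := C) (Lp.memLp u)
    ((by fun_prop : Continuous fun x => (m x : ℂ)).aestronglyMeasurable.mul
      (Lp.aestronglyMeasurable u)) (Filter.Eventually.of_forall fun x => ?_)
  rw [norm_mul, Complex.norm_real, Real.norm_eq_abs]
  exact mul_le_mul_of_nonneg_right (hC x) (norm_nonneg _)

theorem integrable_re_inner {d : ℕ} (u g : L2 d) :
    Integrable (fun x => (inner ℂ (u x) (g x)).re) volume :=
  (L2.integrable_inner (𝕜 := ℂ) u g).re

theorem re_inner_eq_integral {d : ℕ} (u g : L2 d) :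
    (inner ℂ u g : ℂ).re = ∫ x, (inner ℂ (u x) (g x)).re := by
  rw [L2.inner_def]
  exact (integral_re (L2.integrable_inner (𝕜 := ℂ) u g)).symm

theorem integrable_bdd_mul {d : ℕ} {m : Space d → ℝ} (hm : Continuous m) {C : ℝ}
    (hC : ∀ x, |m x| ≤ C) {f : Space d → ℝ} (hf : Integrable f volume) :
    Integrable (fun x => m x * f x) volume :=
  hf.bdd_mul hm.aestronglyMeasurable (Filter.Eventually.of_forall hC)

/-- Antisymmetry of `∂_i` is applied to `u` and `m u`, with `m` the truncated coordinate. The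
unbounded `x_i` could not be used directly, since `x_i ∂_i u` need not be in `L²`. -/
theorem two_mul_integral_coordCutoff {d : ℕ} {u g : L2 d} {i : Fin d} (h : IsWeakPartial u i g)
    {c : ℝ} (hc : 0 < c) :
    2 * ∫ x, coordCutoff d i c x * (inner ℂ (u x) (g x)).re
      = -∫ x, coordCutoffDeriv d i c x * ‖u x‖ ^ 2 := by
  have hm := continuous_coordCutoff i c
  have hm' := continuous_coordCutoffDeriv i c
  have hb := abs_coordCutoff_le_div i hc
  have hb' := abs_coordCutoffDeriv_le i c
  have hv := memLp_mul_of_abs_le hm hb u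
  have hk := (memLp_mul_of_abs_le hm' hb' u).add (memLp_mul_of_abs_le hm hb g)
  have hw : IsWeakPartial (hv.toLp _) i (hk.toLp _) := by
    refine isWeakPartial_mul h (hasTemperateGrowth_coordCutoff i c) (fderiv_coordCutoff i c)
      hv.coeFn_toLp ?_
    filter_upwards [hk.coeFn_toLp] with x hx
    rw [hx, Pi.add_apply]
  have h1 := congrArg Complex.re (inner_weakPartial h hw)
  rw [Complex.neg_re, re_inner_eq_integral, re_inner_eq_integral] at h1
  have e1 : ∫ x, (inner ℂ (hv.toLp _ x) (g x)).re
      = ∫ x, coordCutoff d i c x * (inner ℂ (u x) (g x)).re := by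
    refine integral_congr_ae ?_
    filter_upwards [hv.coeFn_toLp] with x hx
    rw [hx]
    simp
    ring
  have e2 : ∫ x, (inner ℂ (hk.toLp _ x) (u x)).re
      = ∫ x, (coordCutoffDeriv d i c x * ‖u x‖ ^ 2
        + coordCutoff d i c x * (inner ℂ (u x) (g x)).re) := by
    refine integral_congr_ae ?_
    filter_upwards [hk.coeFn_toLp] with x hx
    rw [hx, ← Complex.normSq_eq_norm_sq, Complex.normSq_apply]
    simp
    ring
  rw [e1, e2, integral_add (integrable_bdd_mul hm' hb' (integrable_norm_sq u))
    (integrable_bdd_mul hm hb (integrable_re_inner u g))] at h1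
  linarith

theorem integrable_coord_mul_re_inner {d : ℕ} {u g : L2 d} {i : Fin d}
    (hx : MemLp (fun x : Space d => (x i : ℂ) * u x) 2 volume) :
    Integrable (fun x : Space d => x i * (inner ℂ (u x) (g x)).re) volume := by
  refine (integrable_re_inner (hx.toLp _) g).congr ?_
  filter_upwards [hx.coeFn_toLp] with x h
  rw [h]
  simp
  ring

/-- The commutator identity `2 Re ⟨x_i u, ∂_i u⟩ = -‖u‖²`. -/
theorem two_mul_integral_coord {d : ℕ} {u g : L2 d} {i : Fin d} (h : IsWeakPartial u i g)
    (hx : MemLp (fun x : Space d => (x i : ℂ) * u x) 2 volume) :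
    2 * ∫ x : Space d, x i * (inner ℂ (u x) (g x)).re = -‖u‖ ^ 2 := by
  have hint := integrable_coord_mul_re_inner (g := g) hx
  have l1 := tendsto_integral_of_dominated_convergence
    (F := fun (n : ℕ) x => coordCutoff d i (1 / ((n : ℝ) + 1)) x * (inner ℂ (u x) (g x)).re)
    (f := fun x : Space d => x i * (inner ℂ (u x) (g x)).re)
    (fun x : Space d => |x i * (inner ℂ (u x) (g x)).re|)
    (fun n => (continuous_coordCutoff i _).aestronglyMeasurable.mul
      (integrable_re_inner u g).aestronglyMeasurable) hint.abs
    (fun n => Filter.Eventually.of_forall fun x => by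
      rw [Real.norm_eq_abs, abs_mul, abs_mul]
      exact mul_le_mul_of_nonneg_right (abs_coordCutoff_le i _ x) (abs_nonneg _))
    (Filter.Eventually.of_forall fun x => (tendsto_coordCutoff i x).mul_const _)
  have l2 := tendsto_integral_of_dominated_convergence
    (F := fun (n : ℕ) x => coordCutoffDeriv d i (1 / ((n : ℝ) + 1)) x * ‖u x‖ ^ 2)
    (f := fun x : Space d => 1 * ‖u x‖ ^ 2)
    (fun x : Space d => 3 * ‖u x‖ ^ 2)
    (fun n => (continuous_coordCutoffDeriv i _).aestronglyMeasurable.mul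
      (integrable_norm_sq u).aestronglyMeasurable) ((integrable_norm_sq u).const_mul 3)
    (fun n => Filter.Eventually.of_forall fun x => by
      rw [Real.norm_eq_abs, abs_mul, abs_of_nonneg (sq_nonneg ‖u x‖)]
      exact mul_le_mul_of_nonneg_right (abs_coordCutoffDeriv_le i _ x) (sq_nonneg _))
    (Filter.Eventually.of_forall fun x => (tendsto_coordCutoffDeriv i x).mul_const _)
  have l3 := tendsto_nhds_unique (l1.const_mul 2)
    (l2.neg.congr fun n => (two_mul_integral_coordCutoff h (c := 1 / ((n : ℝ) + 1))
      (by positivity)).symm)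
  rw [l3, norm_sq_eq_integral]
  simp

/-- Completing the square in the harmonic oscillator. -/
theorem integral_norm_sq_annihilate {d : ℕ} {u g : L2 d} {i : Fin d} (h : IsWeakPartial u i g)
    (hx : MemLp (fun x : Space d => (x i : ℂ) * u x) 2 volume) (κ : ℝ) :
    ∫ x : Space d, ‖g x + κ * x i * u x‖ ^ 2
      = ‖g‖ ^ 2 + κ ^ 2 * (∫ x : Space d, x i ^ 2 * ‖u x‖ ^ 2) - κ * ‖u‖ ^ 2 := by
  have hint := integrable_coord_mul_re_inner (g := g) hx
  have hx2 : Integrable (fun x : Space d => x i ^ 2 * ‖u x‖ ^ 2) volume := by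
    have := hx.integrable_norm_pow two_ne_zero
    refine this.congr (Filter.Eventually.of_forall fun x => ?_)
    simp [mul_pow]
  have e : ∀ x : Space d, ‖g x + κ * x i * u x‖ ^ 2
      = ‖g x‖ ^ 2 + κ ^ 2 * (x i ^ 2 * ‖u x‖ ^ 2)
        + 2 * κ * (x i * (inner ℂ (u x) (g x)).re) := fun x => by
    simp only [← Complex.normSq_eq_norm_sq, Complex.normSq_apply]
    simp
    ring
  simp_rw [e]
  have hs : Integrable (fun x : Space d => ‖g x‖ ^ 2 + κ ^ 2 * (x i ^ 2 * ‖u x‖ ^ 2)) volume :=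
    (integrable_norm_sq g).add (hx2.const_mul _)
  rw [integral_add hs (hint.const_mul _),
    integral_add (integrable_norm_sq g) (hx2.const_mul _), integral_const_mul, integral_const_mul,
    norm_sq_eq_integral g]
  have := two_mul_integral_coord h hx
  linear_combination κ * this

/-! ### The kernel of the annihilation operators. -/

open scoped Convolution in
/-- A locally integrable function with vanishing distributional gradient is constant. -/
theorem ae_eq_const_of_weak_gradient_zero {d : ℕ} {w : Space d → ℂ}
    (hw : LocallyIntegrable w volume)
    (h : ∀ (i : Fin d) (η : Space d → ℝ), ContDiff ℝ ∞ η → HasCompactSupport η →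
      ∫ x, fderiv ℝ η x (EuclideanSpace.single i 1) • w x = 0) :
    ∃ c : ℂ, ∀ᵐ x, w x = c := by
  let φ : ℕ → ContDiffBump (0 : Space d) := fun n =>
    ⟨1 / ((n : ℝ) + 1), 2 * (1 / ((n : ℝ) + 1)), by positivity,
      lt_mul_of_one_lt_left (by positivity) (by norm_num)⟩
  -- The derivative of a mollification falls on the bump, and the reflected, translated bump is
  -- again a test function, so the mollification has zero gradient.
  have hconst : ∀ n x y, ((φ n).normed volume ⋆[ContinuousLinearMap.lsmul ℝ ℝ] w) x
      = ((φ n).normed volume ⋆[ContinuousLinearMap.lsmul ℝ ℝ] w) y := by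
    intro n
    set ρ := (φ n).normed (volume : Measure (Space d)) with hρ
    have hρ1 : ContDiff ℝ ∞ ρ := (φ n).contDiff_normed
    have hρ2 : HasCompactSupport ρ := (φ n).hasCompactSupport_normed
    rw [← convolution_flip]
    have hder := hρ2.hasFDerivAt_convolution_right (ContinuousLinearMap.lsmul ℝ ℝ).flip hw
      (hρ1.of_le (by simp))
    refine is_const_of_fderiv_eq_zero (𝕜 := ℝ) (fun x => (hder x).differentiableAt) fun x => ?_
    rw [(hder x).fderiv]
    have hz : ∀ i : Fin d, (w ⋆[(ContinuousLinearMap.lsmul ℝ ℝ).flip.precompR (Space d)]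
        fderiv ℝ ρ) x (EuclideanSpace.single i 1) = 0 := by
      intro i
      rw [convolution_precompR_apply _ hw (hρ2.fderiv ℝ) (hρ1.continuous_fderiv (by simp)),
        convolution_def]
      have hη : ContDiff ℝ ∞ fun t => ρ (x - t) := hρ1.comp (by fun_prop)
      have hηc : HasCompactSupport fun t => ρ (x - t) :=
        hρ2.comp_homeomorph (Homeomorph.subLeft x)
      have h1 := h i _ hη hηc
      have h2 : ∀ t, fderiv ℝ (fun t => ρ (x - t)) t (EuclideanSpace.single i 1)
          = -fderiv ℝ ρ (x - t) (EuclideanSpace.single i 1) := fun t => by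
        have := (hρ1.differentiable (by simp) (x - t)).hasFDerivAt.comp t
          ((hasFDerivAt_id t).const_sub x)
        have h3 : HasFDerivAt (fun t => ρ (x - t)) _ t := this
        rw [h3.fderiv]
        simp
      simp only [h2, neg_smul, integral_neg, neg_eq_zero] at h1
      exact h1
    ext v
    have hv : v = ∑ i, v i • (EuclideanSpace.single i (1 : ℝ) : Space d) := by
      simpa using ((EuclideanSpace.basisFun (Fin d) ℝ).sum_repr v).symm
    rw [hv, map_sum]
    simp [hz]
  -- The mollifications, each constant, converge a.e. to `w`; `K = 2` is the ratio of the outer to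
  -- the inner bump radius.
  have hlim := ContDiffBump.ae_convolution_tendsto_right_of_locallyIntegrable (μ := volume)
    (φ := φ) (l := Filter.atTop) (K := 2) (by
      have := (tendsto_one_div_add_atTop_nhds_zero_nat (𝕜 := ℝ)).const_mul 2
      rw [mul_zero] at this
      exact this) (Filter.Eventually.of_forall fun n => le_rfl) hw
  obtain ⟨x₀, hx₀⟩ := hlim.exists
  refine ⟨w x₀, ?_⟩
  filter_upwards [hlim] with x hx
  exact tendsto_nhds_unique (hx.congr fun n => hconst n x x₀) hx₀

/-- The kernel of all annihilation operators consists of multiples of the Gaussian. -/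
theorem exists_eq_const_mul_gaussian {d : ℕ} {u : L2 d} {g : Fin d → L2 d} {κ : ℝ}
    (h : ∀ i, IsWeakPartial u i (g i))
    (hg : ∀ i, ∀ᵐ x : Space d, g i x = -κ * x i * u x) :
    ∃ c : ℂ, ∀ᵐ x : Space d, u x = c * (Real.exp (-κ * ‖x‖ ^ 2 / 2) : ℝ) := by
  -- `E` is the integrating factor: `E u` has zero gradient. Its growth is harmless, because it only
  -- multiplies compactly supported test functions.
  set E : Space d → ℝ := fun x => Real.exp (κ * ‖x‖ ^ 2 / 2) with hE
  have hE1 : ContDiff ℝ ∞ E := by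
    have : ContDiff ℝ ∞ fun x : Space d => ‖x‖ ^ 2 := contDiff_norm_sq ℝ
    exact (((contDiff_const (c := κ)).mul this).div_const 2).exp
  have hE2 : ∀ (x : Space d) (i : Fin d),
      fderiv ℝ E x (EuclideanSpace.single i 1) = κ * x i * E x := fun x i => by
    have := ((((hasFDerivAt_norm_sq x).const_mul κ).mul_const (1 / 2)).exp)
    have h3 : HasFDerivAt E _ x := this.congr_of_eventuallyEq
      (Filter.Eventually.of_forall fun y => by simp only [hE]; congr 1; ring)
    rw [h3.fderiv]
    simp [EuclideanSpace.inner_single_right, hE]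
    ring_nf
  have hl : LocallyIntegrable (u : Space d → ℂ) volume :=
    (Lp.memLp u).locallyIntegrable (by norm_num)
  obtain ⟨c, hc⟩ := ae_eq_const_of_weak_gradient_zero (w := fun x => (E x : ℂ) * u x)
    (hl.continuous_smul (show Continuous fun x => (E x : ℂ) from
      Complex.continuous_ofReal.comp hE1.continuous)) (fun i η hη hηc => by
      have h1 := (isWeakPartial_iff_integral.1 (h i)) (testFun (fun x => η x * E x) (hη.mul hE1)
        hηc.mul_right)
      rw [eq_neg_iff_add_eq_zero, ← integral_add (integrable_schwartz_mul _ _)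
        (integrable_fderiv_schwartz_mul _ _ _)] at h1
      rw [← h1]
      refine integral_congr_ae ?_
      filter_upwards [hg i] with x hx
      have hd : fderiv ℝ (testFun (fun x => η x * E x) (hη.mul hE1) hηc.mul_right) x
          (EuclideanSpace.single i 1)
          = ((fderiv ℝ η x (EuclideanSpace.single i 1) * E x + η x * (κ * x i * E x) : ℝ) : ℂ) := by
        have h2 := (hη.differentiable (by simp) x).hasFDerivAt.mul
          (hE1.differentiable (by simp) x).hasFDerivAt
        have h3 : HasFDerivAt (testFun (fun x => η x * E x) (hη.mul hE1) hηc.mul_right) _ x :=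
          Complex.ofRealCLM.hasFDerivAt.comp x h2
        rw [h3.fderiv]
        simp [hE2]
        ring
      rw [hd, testFun_apply, hx]
      simp
      ring)
  refine ⟨c, ?_⟩
  filter_upwards [hc] with x hx
  rw [← hx, mul_right_comm, ← Complex.ofReal_mul, hE, ← Real.exp_add]
  ring_nf
  simp

/-! ### Summation over the coordinates. -/

theorem memLp_coord_mul {d : ℕ} {u : L2 d}
    (hu : MemLp (fun x : Space d => (‖x‖ : ℂ) * u x) 2 volume) (i : Fin d) :
    MemLp (fun x : Space d => (x i : ℂ) * u x) 2 volume := by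
  refine hu.mono ((by fun_prop : Continuous fun x : Space d => (x i : ℂ)).aestronglyMeasurable.mul
      (Lp.aestronglyMeasurable u)) (Filter.Eventually.of_forall fun x => ?_)
  rw [norm_mul, norm_mul, Complex.norm_real, Complex.norm_real, norm_norm, Real.norm_eq_abs]
  exact mul_le_mul_of_nonneg_right (abs_le_of_sq_le_sq (sq_coord_le i x) (norm_nonneg x))
    (norm_nonneg _)

theorem integrable_coord_sq {d : ℕ} {u : L2 d}
    (hu : MemLp (fun x : Space d => (‖x‖ : ℂ) * u x) 2 volume) (i : Fin d) :
    Integrable (fun x : Space d => x i ^ 2 * ‖u x‖ ^ 2) volume := by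
  refine ((memLp_coord_mul hu i).integrable_norm_pow two_ne_zero).congr
    (Filter.Eventually.of_forall fun x => ?_)
  simp [mul_pow]

theorem integrable_moment {d : ℕ} {u : L2 d}
    (hu : MemLp (fun x : Space d => (‖x‖ : ℂ) * u x) 2 volume) :
    Integrable (fun x : Space d => ‖x‖ ^ 2 * ‖u x‖ ^ 2) volume := by
  refine (hu.integrable_norm_pow two_ne_zero).congr (Filter.Eventually.of_forall fun x => ?_)
  simp [mul_pow]

theorem momentSq_eq_sum {d : ℕ} {u : L2 d}
    (hu : MemLp (fun x : Space d => (‖x‖ : ℂ) * u x) 2 volume) :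
    momentSq u = ∑ i : Fin d, ∫ x : Space d, x i ^ 2 * ‖u x‖ ^ 2 := by
  rw [momentSq, ← integral_finsetSum _ fun i _ => integrable_coord_sq hu i]
  refine integral_congr_ae (Filter.Eventually.of_forall fun x => ?_)
  simp only
  rw [EuclideanSpace.real_norm_sq_eq, Finset.sum_mul]

/-- The sum of the squared norms of the annihilation operators applied to `u`. -/
def annihilationSq {d : ℕ} (κ : ℝ) (u : L2 d) : ℝ :=
  ∑ i : Fin d, ∫ x : Space d, ‖weakPartial u i x + κ * x i * u x‖ ^ 2

theorem annihilationSq_eq {d : ℕ} {u : L2 d} (hu : u ∈ Sigma d) (κ : ℝ) :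
    annihilationSq κ u = gradSq u + κ ^ 2 * momentSq u - κ * d * ‖u‖ ^ 2 := by
  rw [annihilationSq, momentSq_eq_sum hu.2, gradSq, Finset.mul_sum, ← Finset.sum_add_distrib]
  rw [Finset.sum_congr rfl fun i _ => integral_norm_sq_annihilate
    (isWeakPartial_weakPartial hu.1 i) (memLp_coord_mul hu.2 i) κ]
  simp
  ring

theorem annihilationSq_nonneg {d : ℕ} (κ : ℝ) (u : L2 d) : 0 ≤ annihilationSq κ u :=
  Finset.sum_nonneg fun _ _ => integral_nonneg fun _ => by positivity

/-! ### The Gibbs inequality and the lower bound for the Nehari functional. -/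

theorem integrable_gaussian {d : ℕ} {κ : ℝ} (hκ : 0 < κ) :
    Integrable (fun x : Space d => Real.exp (-κ * ‖x‖ ^ 2)) volume := by
  -- The integral of a non-integrable function is 0 by convention, so a nonzero value certifies
  -- integrability.
  refine Integrable.of_integral_ne_zero ?_
  rw [GaussianFourier.integral_rexp_neg_mul_sq_norm hκ]
  positivity

/-- Convex duality between `t ln t` and the exponential, from `1 + y ≤ exp y` at `y = b - ln t`. -/
theorem add_sub_exp_le_mul_log {t : ℝ} (ht : 0 ≤ t) (b : ℝ) :
    t * b + t - Real.exp b ≤ t * Real.log t := by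
  rcases ht.eq_or_lt with rfl | ht
  · simp [(Real.exp_pos b).le]
  · have h := Real.add_one_le_exp (b - Real.log t)
    rw [Real.exp_sub, Real.exp_log ht, le_div_iff₀ ht] at h
    linarith

theorem integrable_gibbs {d : ℕ} {u : L2 d} (hu : u ∈ Sigma d) {κ : ℝ} (hκ : 0 < κ) (a : ℝ) :
    Integrable (fun x : Space d => ‖u x‖ ^ 2 * (a - κ * ‖x‖ ^ 2) + ‖u x‖ ^ 2
      - Real.exp (a - κ * ‖x‖ ^ 2)) volume := by
  have h1 := (((integrable_norm_sq u).const_mul (a + 1)).sub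
    ((integrable_moment hu.2).const_mul κ)).sub ((integrable_gaussian (d := d) hκ).const_mul
      (Real.exp a))
  refine h1.congr (Filter.Eventually.of_forall fun x => ?_)
  simp only [Pi.sub_apply]
  rw [← Real.exp_add]
  ring_nf

theorem integral_gibbs {d : ℕ} {u : L2 d} (hu : u ∈ Sigma d) {κ : ℝ} (hκ : 0 < κ) (a : ℝ) :
    ∫ x : Space d, (‖u x‖ ^ 2 * (a - κ * ‖x‖ ^ 2) + ‖u x‖ ^ 2 - Real.exp (a - κ * ‖x‖ ^ 2))
      = a * ‖u‖ ^ 2 - κ * momentSq u + ‖u‖ ^ 2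
        - Real.exp a * (Real.pi / κ) ^ ((d : ℝ) / 2) := by
  have e : ∀ x : Space d, ‖u x‖ ^ 2 * (a - κ * ‖x‖ ^ 2) + ‖u x‖ ^ 2
      - Real.exp (a - κ * ‖x‖ ^ 2) = (a + 1) * ‖u x‖ ^ 2 - κ * (‖x‖ ^ 2 * ‖u x‖ ^ 2)
        - Real.exp a * Real.exp (-κ * ‖x‖ ^ 2) := fun x => by
    rw [← Real.exp_add]
    ring_nf
  simp_rw [e]
  have i1 := (integrable_norm_sq u).const_mul (a + 1)
  have i2 := (integrable_moment hu.2).const_mul κ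
  have i3 : Integrable (fun x : Space d => (a + 1) * ‖u x‖ ^ 2 - κ * (‖x‖ ^ 2 * ‖u x‖ ^ 2))
    volume := i1.sub i2
  rw [integral_sub i3 ((integrable_gaussian (d := d) hκ).const_mul _),
    integral_sub i1 i2, integral_const_mul, integral_const_mul, integral_const_mul,
    GaussianFourier.integral_rexp_neg_mul_sq_norm hκ, ← norm_sq_eq_integral, momentSq]
  simp
  ring

/-- `H¹` controls the positive part. The finite moment bounds the integrand from below, through the
pointwise Gibbs inequality with weight `exp (-|x|²)`. -/
theorem integrable_sq_log {d : ℕ} (hd : 1 ≤ d) {u : L2 d} (hu : u ∈ Sigma d) :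
    Integrable (fun x => ‖u x‖ ^ 2 * Real.log (‖u x‖ ^ 2)) volume := by
  have h1 := integrable_posPart_sq_log hd hu.1
  have h2 := integrable_gibbs hu one_pos 0
  have hmeas := (Lp.stronglyMeasurable u).measurable
  refine (h1.add h2.abs).mono'
    ((hmeas.norm.pow_const 2).mul (hmeas.norm.pow_const 2).log).aestronglyMeasurable
    (Filter.Eventually.of_forall fun x => ?_)
  have h3 := add_sub_exp_le_mul_log (sq_nonneg ‖u x‖) (0 - 1 * ‖x‖ ^ 2)
  rw [Real.norm_eq_abs, abs_le]
  have h4 := neg_abs_le (‖u x‖ ^ 2 * (0 - 1 * ‖x‖ ^ 2) + ‖u x‖ ^ 2 - Real.exp (0 - 1 * ‖x‖ ^ 2))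
  have h5 := le_max_left (‖u x‖ ^ 2 * Real.log (‖u x‖ ^ 2)) 0
  have h6 := le_max_right (‖u x‖ ^ 2 * Real.log (‖u x‖ ^ 2)) 0
  have h7 := abs_nonneg (‖u x‖ ^ 2 * (0 - 1 * ‖x‖ ^ 2) + ‖u x‖ ^ 2 - Real.exp (0 - 1 * ‖x‖ ^ 2))
  simp only [Pi.add_apply]
  constructor <;> linarith

/-- The Gibbs variational inequality for the density `|u|²`. -/
theorem gibbs_le_entropy {d : ℕ} (hd : 1 ≤ d) {u : L2 d} (hu : u ∈ Sigma d) {κ : ℝ} (hκ : 0 < κ)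
    (a : ℝ) :
    a * ‖u‖ ^ 2 - κ * momentSq u + ‖u‖ ^ 2 - Real.exp a * (Real.pi / κ) ^ ((d : ℝ) / 2)
      ≤ ∫ x, ‖u x‖ ^ 2 * Real.log (‖u x‖ ^ 2) := by
  rw [← integral_gibbs hu hκ]
  exact integral_mono (integrable_gibbs hu hκ a) (integrable_sq_log hd hu)
    fun x => add_sub_exp_le_mul_log (sq_nonneg _) _

/-- The exponent of the normalisation of the squared Gausson. -/
def gaussonExponent (d : ℕ) (lam κ ν : ℝ) : ℝ := -(ν + κ * d / 2) / lam

/-- The exponent is chosen so that `2 lam a = -(2ν + κ d)`. The Gibbs bound then cancels the `2ν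
‖u‖²` term, the `κ d ‖u‖²` left by completing the square, and the `2 lam κ` share of the moment
term. -/
theorem annihilationSq_add_le_nehari {d : ℕ} (hd : 1 ≤ d) {lam κ : ℝ} (hlam : 0 < lam) (hκ : 0 < κ)
    (ν : ℝ) {u : L2 d} (hu : u ∈ Sigma d) :
    annihilationSq κ u + 2 * lam * (‖u‖ ^ 2
        - Real.exp (gaussonExponent d lam κ ν) * (Real.pi / κ) ^ ((d : ℝ) / 2))
      ≤ nehari lam κ ν u := by
  have h1 := gibbs_le_entropy hd hu hκ (gaussonExponent d lam κ ν)
  have h2 : lam * gaussonExponent d lam κ ν = -(ν + κ * d / 2) := by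
    rw [gaussonExponent]; field_simp
  have h3 := mul_le_mul_of_nonneg_left h1 (by positivity : 0 ≤ 2 * lam)
  rw [annihilationSq_eq hu, nehari, omegaSq]
  have h4 : 2 * lam * (gaussonExponent d lam κ ν * ‖u‖ ^ 2)
      = -(2 * ν + κ * d) * ‖u‖ ^ 2 := by
    linear_combination 2 * ‖u‖ ^ 2 * h2
  linarith

theorem action_eq {d : ℕ} (hd : 1 ≤ d) (lam κ ν : ℝ) {u : L2 d} (hu : u ∈ Sigma d) :
    action lam κ ν u = nehari lam κ ν u / 2 - lam * ‖u‖ ^ 2 := by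
  have h1 : ∫ x : Space d, harmonicPotential d lam κ x * ‖u x‖ ^ 2
      = omegaSq lam κ / 2 * momentSq u := by
    rw [momentSq, ← integral_const_mul]
    simp only [harmonicPotential, mul_assoc]
  have h2 : ∫ x : Space d, ‖u x‖ ^ 2 * (Real.log (‖u x‖ ^ 2) - 1)
      = (∫ x, ‖u x‖ ^ 2 * Real.log (‖u x‖ ^ 2)) - ‖u‖ ^ 2 := by
    rw [norm_sq_eq_integral, ← integral_sub (integrable_sq_log hd hu) (integrable_norm_sq u)]
    simp only [mul_sub, mul_one]
  rw [action, energy, nehari, h1, h2]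
  ring

/-! ### Membership in `Σ` and invariance under a phase. -/

/-- An `L²` function all of whose weak partial derivatives are in `L²` belongs to `H¹`. -/
theorem memH1_of_isWeakPartial {d : ℕ} {u : L2 d} {g : Fin d → L2 d}
    (h : ∀ i, IsWeakPartial u i (g i)) : MemH1 u := by
  set v : L2 d := 𝓕 u with hv
  have hm : AEStronglyMeasurable (fun ξ => besselWeight d (1 / 2) ξ * v ξ) volume :=
    (hasTemperateGrowth_besselWeight d (1 / 2)).1.continuous.aestronglyMeasurable.mul
      (Lp.aestronglyMeasurable v)
  have hL : MemLp (fun ξ => besselWeight d (1 / 2) ξ * v ξ) 2 volume := by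
    rw [memLp_two_iff_integrable_sq_norm hm]
    -- By the Fourier form of the derivatives, this sum is `(1 + |ξ|²) |v|²`.
    have hi : Integrable (fun ξ => ‖v ξ‖ ^ 2
        + ((2 * Real.pi) ^ 2)⁻¹ * ∑ i, ‖(𝓕 (g i) : L2 d) ξ‖ ^ 2) volume :=
      (integrable_norm_sq v).add ((integrable_finsetSum _ fun i _ =>
        integrable_norm_sq (𝓕 (g i) : L2 d)).const_mul _)
    refine hi.congr ?_
    filter_upwards [ae_all_iff.2 fun i => isWeakPartial_iff_fourier.1 (h i)] with ξ hξ
    rw [norm_mul, mul_pow ‖besselWeight d (1 / 2) ξ‖, norm_sq_besselWeight_half,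
      EuclideanSpace.real_norm_sq_eq, add_mul, one_mul, Finset.sum_mul, Finset.mul_sum]
    congr 1
    refine Finset.sum_congr rfl fun i _ => ?_
    rw [hξ i]
    simp only [norm_mul, Complex.norm_real, Complex.norm_I, Complex.norm_ofNat, Real.norm_eq_abs,
      mul_pow, sq_abs, mul_one, hv]
    field_simp
  exact memH1_iff_fourier.2 ⟨hL.toLp _, hL.coeFn_toLp⟩

theorem isWeakPartial_smul {d : ℕ} {u g : L2 d} {i : Fin d} (h : IsWeakPartial u i g) (c : ℂ) :
    IsWeakPartial (c • u) i (c • g) := by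
  rw [isWeakPartial_iff_fourier] at h ⊢
  rw [FourierTransform.fourier_smul, FourierTransform.fourier_smul]
  filter_upwards [h, Lp.coeFn_smul c (𝓕 u : L2 d), Lp.coeFn_smul c (𝓕 g : L2 d)] with ξ h1 h2 h3
  rw [h2, h3, Pi.smul_apply, Pi.smul_apply, h1, smul_eq_mul, smul_eq_mul]
  ring

theorem smul_mem_Sigma {d : ℕ} {u : L2 d} (hu : u ∈ Sigma d) (c : ℂ) : c • u ∈ Sigma d := by
  refine ⟨memH1_of_isWeakPartial fun i => isWeakPartial_smul (isWeakPartial_weakPartial hu.1 i) c,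
    (hu.2.const_mul c).ae_eq ?_⟩
  filter_upwards [Lp.coeFn_smul c u] with x hx
  rw [hx, Pi.smul_apply, smul_eq_mul]
  ring

theorem nehari_smul {d : ℕ} {u : L2 d} (hu : u ∈ Sigma d) {c : ℂ} (hc : ‖c‖ = 1)
    (lam κ ν : ℝ) : nehari lam κ ν (c • u) = nehari lam κ ν u := by
  have hg : gradSq (c • u) = gradSq u := by
    refine Finset.sum_congr rfl fun i _ => ?_
    rw [← (isWeakPartial_smul (isWeakPartial_weakPartial hu.1 i) c).eq, norm_smul, hc, one_mul]
  have hn : ∀ᵐ x, ‖(c • u : L2 d) x‖ = ‖u x‖ := by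
    filter_upwards [Lp.coeFn_smul c u] with x hx
    rw [hx, Pi.smul_apply, norm_smul, hc, one_mul]
  have hm : momentSq (c • u) = momentSq u := by
    refine integral_congr_ae ?_
    filter_upwards [hn] with x hx
    rw [hx]
  have he : ∫ x, ‖(c • u : L2 d) x‖ ^ 2 * Real.log (‖(c • u : L2 d) x‖ ^ 2)
      = ∫ x, ‖u x‖ ^ 2 * Real.log (‖u x‖ ^ 2) := by
    refine integral_congr_ae ?_
    filter_upwards [hn] with x hx
    rw [hx]
  rw [nehari, nehari, hg, hm, he, norm_smul, hc, one_mul]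

/-! ### The Gausson saturates both inequalities. -/

theorem gausson_ae (d : ℕ) (lam : ℝ) {κ : ℝ} (hκ : 0 < κ) (ν : ℝ) :
    gausson d lam hκ ν =ᵐ[volume] gaussonFun d lam κ ν :=
  MemLp.coeFn_toLp _

theorem norm_sq_gaussonFun {d : ℕ} (lam κ ν : ℝ) (x : Space d) :
    ‖gaussonFun d lam κ ν x‖ ^ 2
      = Real.exp (gaussonExponent d lam κ ν) * Real.exp (-κ * ‖x‖ ^ 2) := by
  rw [gaussonFun, Complex.norm_real, Real.norm_eq_abs, sq_abs, mul_pow, ← Real.exp_nat_mul,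
    ← Real.exp_nat_mul, gaussonExponent]
  congr 2
  · push_cast
    rw [mul_comm 2 lam, ← div_div]
    ring
  · push_cast
    ring

theorem norm_sq_gausson (d : ℕ) (lam : ℝ) {κ : ℝ} (hκ : 0 < κ) (ν : ℝ) :
    ‖gausson d lam hκ ν‖ ^ 2
      = Real.exp (gaussonExponent d lam κ ν) * (Real.pi / κ) ^ ((d : ℝ) / 2) := by
  rw [norm_sq_eq_integral]
  have h : ∫ x, ‖gausson d lam hκ ν x‖ ^ 2 = ∫ x : Space d,
      Real.exp (gaussonExponent d lam κ ν) * Real.exp (-κ * ‖x‖ ^ 2) := by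
    refine integral_congr_ae ?_
    filter_upwards [gausson_ae d lam hκ ν] with x hx
    rw [hx, norm_sq_gaussonFun]
  rw [h, integral_const_mul, GaussianFourier.integral_rexp_neg_mul_sq_norm hκ]
  simp

theorem memLp_norm_mul_gaussonFun (d : ℕ) (lam : ℝ) {κ : ℝ} (hκ : 0 < κ) (ν : ℝ) :
    MemLp (fun x : Space d => (‖x‖ : ℂ) * gaussonFun d lam κ ν x) 2 volume := by
  have hc : Continuous (gaussonFun d lam κ ν) := by
    unfold gaussonFun
    fun_prop
  rw [memLp_two_iff_integrable_sq_norm (by fun_prop)]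
  -- Half of the Gaussian decay pays for the factor `|x|²`.
  have hi := (integrable_gaussian (d := d) (half_pos hκ)).const_mul
    (2 / κ * Real.exp (gaussonExponent d lam κ ν))
  refine hi.mono' (by fun_prop) (Filter.Eventually.of_forall fun x => ?_)
  rw [norm_mul, mul_pow, norm_sq_gaussonFun, Complex.norm_real, norm_norm, norm_mul, norm_mul,
    norm_pow, norm_norm, Real.norm_eq_abs, Real.norm_eq_abs, Real.abs_exp, Real.abs_exp]
  have h1 : κ / 2 * ‖x‖ ^ 2 ≤ Real.exp (κ / 2 * ‖x‖ ^ 2) := by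
    have := Real.add_one_le_exp (κ / 2 * ‖x‖ ^ 2)
    linarith
  have h2 : ‖x‖ ^ 2 ≤ 2 / κ * Real.exp (κ / 2 * ‖x‖ ^ 2) := by
    calc ‖x‖ ^ 2 = 2 / κ * (κ / 2 * ‖x‖ ^ 2) := by field_simp
      _ ≤ _ := by gcongr
  have h3 : Real.exp (κ / 2 * ‖x‖ ^ 2) * Real.exp (-κ * ‖x‖ ^ 2)
      = Real.exp (-(κ / 2) * ‖x‖ ^ 2) := by
    rw [← Real.exp_add]; ring_nf
  calc ‖x‖ ^ 2 * (Real.exp (gaussonExponent d lam κ ν) * Real.exp (-κ * ‖x‖ ^ 2))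
      ≤ 2 / κ * Real.exp (κ / 2 * ‖x‖ ^ 2)
        * (Real.exp (gaussonExponent d lam κ ν) * Real.exp (-κ * ‖x‖ ^ 2)) := by gcongr
    _ = 2 / κ * Real.exp (gaussonExponent d lam κ ν)
        * (Real.exp (κ / 2 * ‖x‖ ^ 2) * Real.exp (-κ * ‖x‖ ^ 2)) := by ring
    _ = _ := by rw [h3]

theorem memLp_norm_mul_gausson (d : ℕ) (lam : ℝ) {κ : ℝ} (hκ : 0 < κ) (ν : ℝ) :
    MemLp (fun x : Space d => (‖x‖ : ℂ) * gausson d lam hκ ν x) 2 volume := by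
  refine (memLp_norm_mul_gaussonFun d lam hκ ν).ae_eq ?_
  filter_upwards [gausson_ae d lam hκ ν] with x hx
  rw [hx]

/-- The candidate `-κ x_i φ` for the partial derivative of the Gausson. -/
def gaussonPartial (d : ℕ) (lam : ℝ) {κ : ℝ} (hκ : 0 < κ) (ν : ℝ) (i : Fin d) : L2 d :=
  (-κ : ℂ) • (memLp_coord_mul (memLp_norm_mul_gausson d lam hκ ν) i).toLp _

theorem gaussonPartial_ae (d : ℕ) (lam : ℝ) {κ : ℝ} (hκ : 0 < κ) (ν : ℝ) (i : Fin d) :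
    ∀ᵐ x : Space d, gaussonPartial d lam hκ ν i x = -κ * x i * gausson d lam hκ ν x := by
  filter_upwards [Lp.coeFn_smul (-κ : ℂ)
      ((memLp_coord_mul (memLp_norm_mul_gausson d lam hκ ν) i).toLp _),
    (memLp_coord_mul (memLp_norm_mul_gausson d lam hκ ν) i).coeFn_toLp] with x h1 h2
  rw [gaussonPartial, h1, Pi.smul_apply, h2, smul_eq_mul]
  ring

theorem differentiableAt_and_fderiv_gaussonFun {d : ℕ} (lam κ ν : ℝ) (x : Space d) :
    DifferentiableAt ℝ (gaussonFun d lam κ ν) x ∧ ∀ i : Fin d,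
      fderiv ℝ (gaussonFun d lam κ ν) x (EuclideanSpace.single i 1)
        = -κ * x i * gaussonFun d lam κ ν x := by
  have h1 := ((((hasFDerivAt_norm_sq x).const_mul (-κ)).mul_const (1 / 2)).exp).const_mul
    (Real.exp (-(ν + κ * d / 2) / (2 * lam)))
  have h2 : HasFDerivAt (gaussonFun d lam κ ν) _ x :=
    (Complex.ofRealCLM.hasFDerivAt.comp x h1).congr_of_eventuallyEq
      (Filter.Eventually.of_forall fun y => by simp [gaussonFun, div_eq_mul_inv])
  refine ⟨h2.differentiableAt, fun i => ?_⟩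
  rw [h2.fderiv]
  simp [gaussonFun, EuclideanSpace.inner_single_right]
  ring_nf

theorem isWeakPartial_gausson (d : ℕ) (lam : ℝ) {κ : ℝ} (hκ : 0 < κ) (ν : ℝ) (i : Fin d) :
    IsWeakPartial (gausson d lam hκ ν) i (gaussonPartial d lam hκ ν i) := by
  rw [isWeakPartial_iff_integral]
  intro ψ
  have hf := fun x : Space d => (differentiableAt_and_fderiv_gaussonFun lam κ ν x).2 i
  have e1 : (fun x => ψ x * gaussonPartial d lam hκ ν i x) =ᵐ[volume]
      fun x => ψ x * fderiv ℝ (gaussonFun d lam κ ν) x (EuclideanSpace.single i 1) := by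
    filter_upwards [gaussonPartial_ae d lam hκ ν i, gausson_ae d lam hκ ν] with x h1 h2
    rw [h1, hf, h2]
  have e2 : (fun x => fderiv ℝ ψ x (EuclideanSpace.single i 1) * gausson d lam hκ ν x)
      =ᵐ[volume]
      fun x => fderiv ℝ ψ x (EuclideanSpace.single i 1) * gaussonFun d lam κ ν x := by
    filter_upwards [gausson_ae d lam hκ ν] with x h2
    rw [h2]
  have e3 : (fun x => ψ x * gausson d lam hκ ν x) =ᵐ[volume]
      fun x => ψ x * gaussonFun d lam κ ν x := by
    filter_upwards [gausson_ae d lam hκ ν] with x h2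
    rw [h2]
  rw [integral_congr_ae e1, integral_congr_ae e2]
  exact integral_mul_fderiv_eq_neg_fderiv_mul_of_integrable
    ((integrable_fderiv_schwartz_mul _ _ _).congr e2) ((integrable_schwartz_mul _ _).congr e1)
    ((integrable_schwartz_mul _ _).congr e3) (fun x _ => ψ.differentiableAt)
    fun x _ => (differentiableAt_and_fderiv_gaussonFun lam κ ν x).1

theorem gausson_mem_Sigma (d : ℕ) (lam : ℝ) {κ : ℝ} (hκ : 0 < κ) (ν : ℝ) :
    gausson d lam hκ ν ∈ Sigma d :=
  ⟨memH1_of_isWeakPartial (isWeakPartial_gausson d lam hκ ν), memLp_norm_mul_gausson d lam hκ ν⟩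

theorem gausson_ne_zero (d : ℕ) (lam : ℝ) {κ : ℝ} (hκ : 0 < κ) (ν : ℝ) :
    gausson d lam hκ ν ≠ 0 := by
  intro h
  have h1 := norm_sq_gausson d lam hκ ν
  rw [h, norm_zero, zero_pow two_ne_zero] at h1
  have : 0 < Real.exp (gaussonExponent d lam κ ν) * (Real.pi / κ) ^ ((d : ℝ) / 2) := by positivity
  linarith

theorem annihilationSq_gausson (d : ℕ) (lam : ℝ) {κ : ℝ} (hκ : 0 < κ) (ν : ℝ) :
    annihilationSq κ (gausson d lam hκ ν) = 0 := by
  refine Finset.sum_eq_zero fun i _ => ?_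
  rw [← (isWeakPartial_gausson d lam hκ ν i).eq]
  refine integral_eq_zero_of_ae ?_
  filter_upwards [gaussonPartial_ae d lam hκ ν i] with x hx
  rw [hx]
  simp

/-- Equality case of Gibbs: `ln |φ_ν|²` is exactly `a - κ |x|²`. -/
theorem entropy_gausson (d : ℕ) (lam : ℝ) {κ : ℝ} (hκ : 0 < κ) (ν : ℝ) :
    ∫ x, ‖gausson d lam hκ ν x‖ ^ 2 * Real.log (‖gausson d lam hκ ν x‖ ^ 2)
      = gaussonExponent d lam κ ν * ‖gausson d lam hκ ν‖ ^ 2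
        - κ * momentSq (gausson d lam hκ ν) := by
  rw [norm_sq_eq_integral, momentSq, ← integral_const_mul, ← integral_const_mul,
    ← integral_sub ((integrable_norm_sq _).const_mul _)
      ((integrable_moment (memLp_norm_mul_gausson d lam hκ ν)).const_mul _)]
  refine integral_congr_ae ?_
  filter_upwards [gausson_ae d lam hκ ν] with x hx
  rw [hx, norm_sq_gaussonFun, ← Real.exp_add, Real.log_exp]
  ring

theorem nehari_gausson (d : ℕ) {lam κ : ℝ} (hlam : 0 < lam) (hκ : 0 < κ) (ν : ℝ) :
    nehari lam κ ν (gausson d lam hκ ν) = 0 := by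
  have h1 := annihilationSq_gausson d lam hκ ν
  rw [annihilationSq_eq (gausson_mem_Sigma d lam hκ ν)] at h1
  have h2 : lam * gaussonExponent d lam κ ν = -(ν + κ * d / 2) := by
    rw [gaussonExponent]; field_simp
  rw [nehari, entropy_gausson, omegaSq]
  linear_combination h1 + 2 * ‖gausson d lam hκ ν‖ ^ 2 * h2

theorem smul_gausson_mem_nehariManifold (d : ℕ) {lam κ : ℝ} (hlam : 0 < lam) (hκ : 0 < κ) (ν : ℝ)
    {c : ℂ} (hc : ‖c‖ = 1) : c • gausson d lam hκ ν ∈ nehariManifold d lam κ ν := by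
  have hS := gausson_mem_Sigma d lam hκ ν
  refine ⟨smul_mem_Sigma hS c, smul_ne_zero (by rintro rfl; simp at hc)
    (gausson_ne_zero d lam hκ ν), ?_⟩
  rw [nehari_smul hS hc, nehari_gausson d hlam hκ ν]

/-! ### Extremality and rigidity. -/

theorem action_of_mem_nehariManifold {d : ℕ} (hd : 1 ≤ d) {lam κ ν : ℝ} {u : L2 d}
    (hu : u ∈ nehariManifold d lam κ ν) : action lam κ ν u = -lam * ‖u‖ ^ 2 := by
  rw [action_eq hd lam κ ν hu.1, hu.2.2]
  ring

theorem norm_sq_le_of_mem_nehariManifold {d : ℕ} (hd : 1 ≤ d) {lam κ ν : ℝ} (hlam : 0 < lam)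
    (hκ : 0 < κ) {u : L2 d} (hu : u ∈ nehariManifold d lam κ ν) :
    ‖u‖ ^ 2 ≤ ‖gausson d lam hκ ν‖ ^ 2 := by
  have h1 := annihilationSq_add_le_nehari hd hlam hκ ν hu.1
  rw [hu.2.2, ← norm_sq_gausson d lam hκ ν] at h1
  have h2 := annihilationSq_nonneg κ u
  have h3 : lam * (‖u‖ ^ 2 - ‖gausson d lam hκ ν‖ ^ 2) ≤ 0 := by linarith
  have h4 := nonpos_of_mul_nonpos_right h3 hlam
  linarith

theorem exists_eq_smul_gausson {d : ℕ} (lam : ℝ) {κ : ℝ} (hκ : 0 < κ) (ν : ℝ) {u : L2 d}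
    (hu : u ∈ Sigma d) (h : annihilationSq κ u = 0) : ∃ c : ℂ, u = c • gausson d lam hκ ν := by
  have hz : ∀ i : Fin d, ∀ᵐ x : Space d, weakPartial u i x = -κ * x i * u x := by
    intro i
    have h1 := (Finset.sum_eq_zero_iff_of_nonneg fun i _ =>
      integral_nonneg fun x => by positivity).1 h i (Finset.mem_univ i)
    have hL : MemLp (fun x : Space d => weakPartial u i x + κ * x i * u x) 2 volume := by
      refine ((Lp.memLp (weakPartial u i)).add
        ((memLp_coord_mul hu.2 i).const_mul (κ : ℂ))).ae_eq ?_
      exact Filter.Eventually.of_forall fun x => by simp [mul_assoc]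
    rw [integral_eq_zero_iff_of_nonneg (fun x => by positivity)
      (hL.integrable_norm_pow two_ne_zero)] at h1
    filter_upwards [h1] with x hx
    have : weakPartial u i x + κ * x i * u x = 0 := by simpa using hx
    linear_combination this
  obtain ⟨c, hc⟩ := exists_eq_const_mul_gaussian (fun i => isWeakPartial_weakPartial hu.1 i) hz
  set A : ℝ := Real.exp (-(ν + κ * d / 2) / (2 * lam)) with hA
  have hA0 : (A : ℂ) ≠ 0 := Complex.ofReal_ne_zero.2 (Real.exp_ne_zero _)
  -- Dividing by `A` removes the normalisation of the Gausson.
  refine ⟨c / A, Lp.ext ?_⟩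
  filter_upwards [hc, gausson_ae d lam hκ ν, Lp.coeFn_smul (c / A : ℂ) (gausson d lam hκ ν)]
    with x h1 h2 h3
  rw [h3, Pi.smul_apply, h2, h1, gaussonFun, ← hA, smul_eq_mul, Complex.ofReal_mul]
  field_simp

theorem exists_mem_Ico_exp_eq {c : ℂ} (hc : ‖c‖ = 1) :
    ∃ θ ∈ Set.Ico (0 : ℝ) (2 * Real.pi), c = Complex.exp (θ * Complex.I) := by
  have h := toIcoMod_mem_Ico Real.two_pi_pos 0 c.arg
  rw [zero_add] at h
  refine ⟨_, h, ?_⟩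
  have h1 := Complex.norm_mul_exp_arg_mul_I c
  rw [hc, Complex.ofReal_one, one_mul] at h1
  conv_lhs => rw [← h1]
  rw [toIcoMod]
  push_cast
  rw [Complex.exp_eq_exp_iff_exists_int]
  exact ⟨toIcoDiv Real.two_pi_pos 0 c.arg, by simp; ring⟩

/-- Attainment at the Gausson makes the `sInf` in `groundEnergy` a true infimum rather than a
default value. -/
theorem isLeast_action {d : ℕ} (hd : 1 ≤ d) {lam κ : ℝ} (hlam : 0 < lam) (hκ : 0 < κ) (ν : ℝ) :
    IsLeast (action lam κ ν '' nehariManifold d lam κ ν) (-lam * ‖gausson d lam hκ ν‖ ^ 2) := by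
  constructor
  · have h1 := smul_gausson_mem_nehariManifold d hlam hκ ν (c := 1) (by simp)
    rw [one_smul] at h1
    exact ⟨_, h1, action_of_mem_nehariManifold hd h1⟩
  · rintro _ ⟨u, hu, rfl⟩
    rw [action_of_mem_nehariManifold hd hu]
    have := mul_le_mul_of_nonneg_left (norm_sq_le_of_mem_nehariManifold hd hlam hκ hu) hlam.le
    linarith

end LogNLS

end

theorem lemma4p3 (d : ℕ) (hd : 1 ≤ d) (lam κ ν : ℝ) (hlam : 0 < lam) (hκ : 0 < κ) :
    IsGLB (LogNLS.action lam κ ν '' LogNLS.nehariManifold d lam κ ν)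
        (LogNLS.groundEnergy d lam κ ν) ∧
      LogNLS.groundEnergy d lam κ ν = -lam * ‖LogNLS.gausson d lam hκ ν‖ ^ 2 ∧
      LogNLS.groundEnergy d lam κ ν
        = -lam * Real.pi ^ ((d : ℝ) / 2) * κ ^ (-(d : ℝ) / 2)
            * Real.exp (-(ν + κ * (d : ℝ) / 2) / lam) ∧
      LogNLS.groundStates d lam κ ν
        = {u | ∃ θ ∈ Set.Ico (0 : ℝ) (2 * Real.pi),
            u = Complex.exp (θ * Complex.I) • LogNLS.gausson d lam hκ ν} := by
  have hleast := LogNLS.isLeast_action hd hlam hκ ν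
  have hE : LogNLS.groundEnergy d lam κ ν = -lam * ‖LogNLS.gausson d lam hκ ν‖ ^ 2 :=
    hleast.csInf_eq
  refine ⟨by rw [hE]; exact hleast.isGLB, hE, ?_, ?_⟩
  · rw [hE, LogNLS.norm_sq_gausson, LogNLS.gaussonExponent,
      Real.div_rpow Real.pi_pos.le hκ.le, neg_div (2 : ℝ) (d : ℝ), Real.rpow_neg hκ.le,
      div_eq_mul_inv (Real.pi ^ ((d : ℝ) / 2))]
    ring
  · ext u
    constructor
    · rintro ⟨hu, hS⟩
      rw [hE, LogNLS.action_of_mem_nehariManifold hd hu] at hS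
      have hn : ‖u‖ ^ 2 = ‖LogNLS.gausson d lam hκ ν‖ ^ 2 :=
        mul_left_cancel₀ (neg_ne_zero.2 hlam.ne') hS
      -- With equal masses the Gibbs term drops out, leaving `annihilationSq κ u ≤ 0`.
      have h1 := LogNLS.annihilationSq_add_le_nehari hd hlam hκ ν hu.1
      rw [hu.2.2, ← LogNLS.norm_sq_gausson d lam hκ ν, hn, sub_self, mul_zero, add_zero] at h1
      obtain ⟨c, rfl⟩ := LogNLS.exists_eq_smul_gausson lam hκ ν hu.1
        (le_antisymm h1 (LogNLS.annihilationSq_nonneg κ u))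
      have hg : 0 < ‖LogNLS.gausson d lam hκ ν‖ :=
        norm_pos_iff.2 (LogNLS.gausson_ne_zero d lam hκ ν)
      -- Equal masses also force `‖c‖ = 1`.
      rw [norm_smul, mul_pow, mul_eq_right₀ (by positivity)] at hn
      obtain ⟨θ, hθ, rfl⟩ := LogNLS.exists_mem_Ico_exp_eq
        ((pow_eq_one_iff_of_nonneg (norm_nonneg c) two_ne_zero).1 hn)
      exact ⟨θ, hθ, rfl⟩
    · rintro ⟨θ, -, rfl⟩
      have hc : ‖Complex.exp (θ * Complex.I)‖ = 1 := Complex.norm_exp_ofReal_mul_I θ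
      have hu := LogNLS.smul_gausson_mem_nehariManifold d hlam hκ ν hc
      refine ⟨hu, ?_⟩
      rw [hE, LogNLS.action_of_mem_nehariManifold hd hu, norm_smul, hc, one_mul]
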